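/- Graph take-away is the following impartial game, played on a finite undirected graph (loops and multiple edges allowed): two players alternate, and a move deletes either one edge, or one vertex together with all edges incident to it; the player who removes the last vertex wins. The nim-value $\mathfrak n(G)\in\{0,1,2,\dots\}$ of a finite graph $G$ is defined recursively by $\mathfrak n(G)=\operatorname{mex}\{\mathfrak n(G') : G' \text{ is obtained from } G \text{ by one move}\}$, where $\operatorname{mex}(S)$ is the least non-negative integer not in $S$; in particular the empty graph has nim-value $0$. For $n\ge 3$ let $W_n$ be the wheel graph, obtained from the cycle graph $C_n$ on $n$ vertices by adding one hub vertex and joining it by an edge to each of the $n$ vertices of the cycle. Theorem. For every integer $n$ with $3\le n\le 25$, $\mathfrak n(W_n)=1$. -/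

import Mathlib

namespace GraphTakeAway

/-- The minimal excluded value: the least natural number that is not in `S`. It is meant for
sets with a non-empty complement, for instance finite ones. -/
noncomputable def mex (S : Set ℕ) : ℕ := sInf Sᶜ

/-- `IsOption G H` says that one legal move of graph take-away turns the multigraph `G` (loops and
multiple edges allowed) into `H`: either one vertex is deleted together with all edges incident to
it, or one edge is deleted and all vertices are kept. -/
def IsOption {α β : Type*} (G H : Graph α β) : Prop :=
  (∃ v ∈ G.vertexSet, H = G.deleteVerts {v}) ∨ (∃ e ∈ G.edgeSet, H = G.deleteEdges {e})

/-- Every move decreases the number of vertices plus the number of edges, so play ends. -/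
theorem IsOption.ncard_lt {α β : Type*} [Finite α] [Finite β] {G H : Graph α β}
    (h : IsOption G H) :
    H.vertexSet.ncard + H.edgeSet.ncard < G.vertexSet.ncard + G.edgeSet.ncard := by
  rcases h with ⟨v, hv, rfl⟩ | ⟨e, he, rfl⟩
  · have h1 : (G.deleteVerts {v}).vertexSet.ncard < G.vertexSet.ncard := by
      rw [Graph.vertexSet_deleteVerts]
      exact Set.ncard_sdiff_singleton_lt_of_mem hv
    have h2 : (G.deleteVerts {v}).edgeSet.ncard ≤ G.edgeSet.ncard :=
      Set.ncard_le_ncard Graph.deleteVerts_le.edgeSet_mono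
    omega
  · have h1 : (G.deleteEdges {e}).edgeSet.ncard < G.edgeSet.ncard := by
      rw [Graph.edgeSet_deleteEdges]
      exact Set.ncard_sdiff_singleton_lt_of_mem he
    have h2 : (G.deleteEdges {e}).vertexSet.ncard ≤ G.vertexSet.ncard :=
      Set.ncard_le_ncard Graph.deleteEdges_le.vertexSet_mono
    omega

/-- The nim-value (Sprague-Grundy value) of a finite multigraph as a position of graph take-away:
the minimal excluded value of the nim-values of its options. In particular the graph with no
vertices, which has no options, has nim-value `0`. -/
noncomputable def nimValue {α β : Type*} [Finite α] [Finite β] (G : Graph α β) : ℕ :=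
  mex {k | ∃ (H : Graph α β) (_ : IsOption G H), nimValue H = k}
termination_by G.vertexSet.ncard + G.edgeSet.ncard
decreasing_by exact IsOption.ncard_lt (by assumption)

/-- The wheel as a simple graph: `none` is the central hub, `some i` are the vertices of the
cycle graph on `n` vertices, and the hub is joined to each vertex of the cycle. -/
def simpleWheel (n : ℕ) : SimpleGraph (Option (Fin n)) where
  Adj
    | none, none => False
    | none, some _ => True
    | some _, none => True
    | some i, some j => (SimpleGraph.cycleGraph n).Adj i j
  symm.symm
    | none, none => id
    | none, some _ => id
    | some _, none => id
    | some _, some _ => fun h => h.symm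
  loopless.irrefl
    | none => id
    | some _ => (SimpleGraph.cycleGraph n).irrefl

/-- The wheel graph `W_n` (used for `3 ≤ n`), with hub `none` and rim vertices `some i`; an edge is
labelled by the unordered pair of its ends. -/
def wheel (n : ℕ) : Graph (Option (Fin n)) (Sym2 (Option (Fin n))) :=
  Graph.ofSimpleGraph (simpleWheel n)

end GraphTakeAway

/-! For even `n`, rotating the rim by half a turn is an involution of the wheel that fixes only the
hub and no edge. Every move off the hub can be answered by its image, so the wheel has the value of
a lone hub, namely 1 (`IsMirrored.nimValue_eq_one`).

For odd `n`, deleting the hub leaves an odd cycle. All its options are paths, of value 1 or 2, so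
the cycle has value 0 and the wheel does not. It remains to see that no option of the wheel has
value 1. For each option other than the cycle there is a reply to a position of value 1: deleting a
rim edge leaves a path with all spokes, and deleting the hub leaves a path with an odd number of
vertices and an even number of edges, of value 1; deleting a rim vertex leaves an even path with all
spokes, which is cut into two equal halves that cancel, leaving the hub alone
(`value_replicate_ne_one`); deleting a spoke is answered by deleting a rim vertex so placed that the
missing spoke becomes one of the two middle spokes of an even path
(`Table.value_replicate_false_replicate`).

The last claim is the only one that needs computation, and the bound `n ≤ 25` comes from it.
Positions made of a hub and paths are encoded by words of spoke letters (`IsHubGraph.nimValue_eq`).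
They are simplified by four facts: without the hub the value depends only on parities
(`value_false`), spokeless paths split off as summands (`value_add_forest`), a palindrome of odd
length shrinks to its centre (`value_palindrome`), and equal paths, up to reversal, cancel
(`value_cancel`, `value_reverse`). A stored table of normal forms is then checked in the kernel,
each entry against entries for smaller positions (`Table.correct_of_checkAll`). -/

namespace GraphTakeAway

/-! ### Grundy functions -/

/-- `f` is a Grundy function of the game with moves `step`: the value of a position is the minimal
excluded value of the values of its options. -/
def IsGrundy {P : Type*} (step : P → P → Prop) (f : P → ℕ) : Prop :=
  ∀ p, (∀ q, step p q → f q ≠ f p) ∧ ∀ k < f p, ∃ q, step p q ∧ f q = k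

/-- `mex` is an infimum, which is meaningful only when some number is missing from the set of option
values. By induction every value is at most the size, so the size of `p` is missed by all its
options. -/
theorem isGrundy_of_eq_mex {P : Type*} {step : P → P → Prop} {f : P → ℕ} (size : P → ℕ)
    (hsize : ∀ p q, step p q → size q < size p)
    (hf : ∀ p, f p = mex {k | ∃ (q : P) (_ : step p q), f q = k}) : IsGrundy step f := by
  have hmem : ∀ n p, size p = n → size p ∉ {k | ∃ (q : P) (_ : step p q), f q = k} := by
    intro n
    induction n using Nat.strong_induction_on with
    | _ n ih =>
      rintro p rfl ⟨q, hq, hk⟩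
      have h1 := hsize p q hq
      have h2 : f q ≤ size q := by
        rw [hf q]
        exact Nat.sInf_le (ih _ h1 q rfl)
      omega
  intro p
  constructor
  · intro q hq h
    have h1 : f p ∈ {k | ∃ (q : P) (_ : step p q), f q = k}ᶜ := by
      rw [hf p]
      exact Nat.sInf_mem ⟨_, hmem _ p rfl⟩
    exact h1 ⟨q, hq, h⟩
  · intro k hk
    rw [hf p] at hk
    have h1 := Nat.notMem_of_lt_sInf hk
    rw [Set.mem_compl_iff, not_not] at h1
    obtain ⟨q, hq, h⟩ := h1
    exact ⟨q, hq, h⟩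

/-- If every option of `q` is matched by an option of `p`, and every option of `p` is matched by an
option of `q` or has an option that is again related to `q`, then `p` and `q` have equal values. -/
theorem IsGrundy.eq_of_simulation {P Q : Type*} {sp : P → P → Prop} {sq : Q → Q → Prop}
    {f : P → ℕ} {g : Q → ℕ} (hf : IsGrundy sp f) (hg : IsGrundy sq g) (size : P → ℕ)
    (hsize : ∀ p q, sp p q → size q < size p) (R : P → Q → Prop)
    (h1 : ∀ p q, R p q → ∀ q', sq q q' → ∃ p', sp p p' ∧ R p' q')
    (h2 : ∀ p q, R p q → ∀ p', sp p p' → (∃ q', sq q q' ∧ R p' q') ∨ ∃ p'', sp p' p'' ∧ R p'' q)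
    {p : P} {q : Q} (hR : R p q) : f p = g q := by
  induction hn : size p using Nat.strong_induction_on generalizing p q with
  | _ n ih =>
    subst hn
    rcases lt_trichotomy (f p) (g q) with h | h | h
    · obtain ⟨q', hq', h'⟩ := (hg q).2 _ h
      obtain ⟨p', hp', hR'⟩ := h1 p q hR q' hq'
      have := ih _ (hsize _ _ hp') hR' rfl
      exact absurd (this.trans h') ((hf p).1 p' hp')
    · exact h
    -- Here `p'` has value `g q`. A matching option of `q` would then share the value of `q`, and a
    -- reply related to `q` would share the value of `p'`; an option never has the value of its
    -- position.
    · obtain ⟨p', hp', h'⟩ := (hf p).2 _ h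
      rcases h2 p q hR p' hp' with ⟨q', hq', hR'⟩ | ⟨p'', hp'', hR'⟩
      · have := ih _ (hsize _ _ hp') hR' rfl
        exact absurd (this.symm.trans h') ((hg q).1 q' hq')
      · have := ih _ ((hsize _ _ hp'').trans (hsize _ _ hp')) hR' rfl
        exact absurd (this.trans h'.symm) ((hf p').1 p'' hp'')

/-- Moves in the sum of two games. -/
inductive SumStep {P Q : Type*} (sp : P → P → Prop) (sq : Q → Q → Prop) : P × Q → P × Q → Prop
  | left {p p' q} : sp p p' → SumStep sp sq (p, q) (p', q)
  | right {p q q'} : sq q q' → SumStep sp sq (p, q) (p, q')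

theorem IsGrundy.sum {P Q : Type*} {sp : P → P → Prop} {sq : Q → Q → Prop}
    {f : P → ℕ} {g : Q → ℕ} (hf : IsGrundy sp f) (hg : IsGrundy sq g) :
    IsGrundy (SumStep sp sq) fun x => f x.1 ^^^ g x.2 := by
  rintro ⟨p, q⟩
  constructor
  · rintro _ (⟨h⟩ | ⟨h⟩) he
    · exact (hf p).1 _ h (Nat.xor_left_injective he)
    · exact (hg q).1 _ h (Nat.xor_right_injective he)
  · intro k hk
    -- The nim-sum strategy: a smaller total is reached by lowering one suitable summand to its xor
    -- with the target.
    rcases Nat.lt_xor_cases hk with h | h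
    · obtain ⟨p', hp', he⟩ := (hf p).2 _ h
      exact ⟨(p', q), .left hp', by simp [he]⟩
    · obtain ⟨q', hq', he⟩ := (hg q).2 _ h
      refine ⟨(p, q'), .right hq', ?_⟩
      simp only [he]
      rw [Nat.xor_comm k, ← Nat.xor_assoc, Nat.xor_self, Nat.zero_xor]

/-- Two functions with the same mex recursion agree on a set of positions closed under moves. -/
theorem IsGrundy.eq_on {P : Type*} {sp : P → P → Prop} {f g : P → ℕ} (hf : IsGrundy sp f)
    (size : P → ℕ) (hsize : ∀ p q, sp p q → size q < size p) (S : P → Prop)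
    (hS : ∀ p q, S p → sp p q → S q) (h1 : ∀ p q, S p → sp p q → g q ≠ g p)
    (h2 : ∀ p, S p → ∀ k < g p, ∃ q, sp p q ∧ g q = k) {p : P} (hp : S p) : f p = g p := by
  induction hn : size p using Nat.strong_induction_on generalizing p with
  | _ n ih =>
    subst hn
    rcases lt_trichotomy (f p) (g p) with h | h | h
    · obtain ⟨q, hq, h'⟩ := h2 p hp _ h
      exact absurd ((ih _ (hsize _ _ hq) (hS _ _ hp hq) rfl).trans h') ((hf p).1 q hq)
    · exact h
    · obtain ⟨q, hq, h'⟩ := (hf p).2 _ h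
      exact absurd ((ih _ (hsize _ _ hq) (hS _ _ hp hq) rfl).symm.trans h') (h1 p q hp hq)

/-- The Grundy function of a game that is bounded in length by `size`. -/
noncomputable def grundy {P : Type*} (step : P → P → Prop) (size : P → ℕ)
    (hsize : ∀ p q, step p q → size q < size p) (p : P) : ℕ :=
  mex {k | ∃ (q : P) (_ : step p q), grundy step size hsize q = k}
termination_by size p
decreasing_by exact hsize _ _ (by assumption)

theorem isGrundy_grundy {P : Type*} (step : P → P → Prop) (size : P → ℕ)
    (hsize : ∀ p q, step p q → size q < size p) : IsGrundy step (grundy step size hsize) :=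
  isGrundy_of_eq_mex size hsize fun p => by rw [grundy]

theorem isGrundy_nimValue {α β : Type*} [Finite α] [Finite β] :
    IsGrundy (IsOption (α := α) (β := β)) nimValue :=
  isGrundy_of_eq_mex (fun G => G.vertexSet.ncard + G.edgeSet.ncard) (fun _ _ h => h.ncard_lt)
    fun G => by rw [nimValue]

/-! ### Paths attached to a hub

A path is encoded by the word that lists, for each of its vertices, whether this vertex is joined
to the hub by a spoke. -/

/-- Moves in a path: the path `w` is replaced by the paths in `P`. The flag tells whether the hub
(and hence the spokes) is present. -/
inductive WordMove (b : Bool) : List Bool → Multiset (List Bool) → Prop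
  | spoke (p q : List Bool) (hb : b = true) : WordMove b (p ++ true :: q) {p ++ false :: q}
  | cut (p q : List Bool) (hp : p ≠ []) (hq : q ≠ []) : WordMove b (p ++ q) {p, q}
  | vertex (p : List Bool) (x : Bool) (q : List Bool) : WordMove b (p ++ x :: q) {p, q}

/-- Moves in a collection of paths; the flag tells whether the hub is present. -/
inductive Move : Bool × Multiset (List Bool) → Bool × Multiset (List Bool) → Prop
  | hub (M) : Move (true, M) (false, M)
  | word {b w P} (M) (h : WordMove b w P) : Move (b, w ::ₘ M) (b, P + M)

/-- A bound for the number of moves in a path. -/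
def wordSize (w : List Bool) : ℕ := w.length + (w.length - 1) + w.count true

/-- A bound for the number of moves in a position. -/
def size (x : Bool × Multiset (List Bool)) : ℕ := x.1.toNat + (x.2.map wordSize).sum

theorem WordMove.size_lt {b w P} (h : WordMove b w P) : (P.map wordSize).sum < wordSize w := by
  cases h with
  | spoke p q hb => simp [wordSize]
  | cut p q hp hq =>
    have := List.length_pos_iff.2 hp
    have := List.length_pos_iff.2 hq
    simp [wordSize]; omega
  | vertex p x q => simp [wordSize, List.count_cons]; omega

theorem Move.size_lt : ∀ x y, Move x y → size y < size x := by
  rintro _ _ (⟨M⟩ | ⟨M, h⟩)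
  · simp [size]
  · have := h.size_lt
    simp [size]; omega

/-- The value of a position. -/
noncomputable def value (b : Bool) (M : Multiset (List Bool)) : ℕ :=
  grundy Move size Move.size_lt (b, M)

theorem isGrundy_value : IsGrundy Move fun x => value x.1 x.2 :=
  isGrundy_grundy Move size Move.size_lt

theorem cons_eq_add {γ : Type*} {w : γ} {N A B : Multiset γ} (h : w ::ₘ N = A + B) :
    (∃ A', A = w ::ₘ A' ∧ N = A' + B) ∨ ∃ B', B = w ::ₘ B' ∧ N = A + B' := by
  have hw : w ∈ A + B := h ▸ Multiset.mem_cons_self w N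
  rcases Multiset.mem_add.1 hw with hw | hw
  · obtain ⟨A', rfl⟩ := Multiset.exists_cons_of_mem hw
    rw [Multiset.cons_add, Multiset.cons_inj_right] at h
    exact .inl ⟨A', rfl, h⟩
  · obtain ⟨B', rfl⟩ := Multiset.exists_cons_of_mem hw
    rw [Multiset.add_cons, Multiset.cons_inj_right] at h
    exact .inr ⟨B', rfl, h⟩

/-! ### Play without the hub: the parity formula. -/

/-- The value of a bipartite graph with `v` vertices and `e` edges. -/
def parity (v e : ℕ) : ℕ := v % 2 + 2 * (e % 2)

/-- The value of a disjoint union of paths. -/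
def forestValue (M : Multiset (List Bool)) : ℕ :=
  parity (M.map List.length).sum (M.map fun w => w.length - 1).sum

theorem exists_odd_of_sum_odd {γ : Type*} (f : γ → ℕ) (M : Multiset γ)
    (h : (M.map f).sum % 2 = 1) : ∃ w N, M = w ::ₘ N ∧ f w % 2 = 1 := by
  by_contra! hc
  have : 2 ∣ (M.map f).sum := by
    refine Multiset.dvd_sum fun x hx => ?_
    obtain ⟨w, hw, rfl⟩ := Multiset.mem_map.1 hx
    obtain ⟨N, rfl⟩ := Multiset.exists_cons_of_mem hw
    have := hc w N rfl
    omega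
  omega

theorem forestValue_cons (w : List Bool) (M : Multiset (List Bool)) :
    forestValue (w ::ₘ M) = parity (w.length + (M.map List.length).sum)
      (w.length - 1 + (M.map fun w => w.length - 1).sum) := by
  simp [forestValue]

theorem forestValue_pair (p q : List Bool) (M : Multiset (List Bool)) :
    forestValue ({p, q} + M) = parity (p.length + q.length + (M.map List.length).sum)
      (p.length - 1 + (q.length - 1) + (M.map fun w => w.length - 1).sum) := by
  simp [forestValue, Nat.add_assoc]

theorem value_false (M : Multiset (List Bool)) : value false M = forestValue M := by
  refine isGrundy_value.eq_on (g := fun x => forestValue x.2) size Move.size_lt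
    (fun x => x.1 = false) ?_ ?_ ?_ (p := (false, M)) rfl
  · rintro _ _ hp (⟨M⟩ | ⟨M, h⟩)
    · cases hp
    · exact hp
  · rintro _ _ hp (⟨M⟩ | ⟨M, h⟩)
    · cases hp
    · cases h with
      | spoke p q hb => subst hb; cases hp
      | cut p q h1 h2 =>
        have := List.length_pos_iff.2 h1
        have := List.length_pos_iff.2 h2
        simp only [forestValue_cons, forestValue_pair, parity, List.length_append]
        omega
      | vertex p x q =>
        simp only [forestValue_cons, forestValue_pair, parity, List.length_append,
          List.length_cons]
        omega
  · rintro ⟨b, M⟩ hb k hk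
    obtain rfl : b = false := hb
    -- An edge deletion changes only the parity of the edges.
    have hedge : (M.map fun w => w.length - 1).sum % 2 = 1 → ∃ q, Move (false, M) q ∧
        forestValue q.2 = (M.map List.length).sum % 2 := by
      intro h
      obtain ⟨w, N, rfl, hw⟩ := exists_odd_of_sum_odd _ _ h
      match w, hw with
      | x :: y :: t, hw =>
        refine ⟨_, .word N (.cut [x] (y :: t) (by simp) (by simp)), ?_⟩
        simp only [forestValue_pair, parity, Multiset.map_cons, Multiset.sum_cons,
          List.length_cons, List.length_nil] at hw h ⊢
        omega
    -- Deleting an end vertex of a path that has an edge changes both parities.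
    have hend : (M.map fun w => w.length - 1).sum % 2 = 1 → ∃ q, Move (false, M) q ∧
        forestValue q.2 = ((M.map List.length).sum + 1) % 2 := by
      intro h
      obtain ⟨w, N, rfl, hw⟩ := exists_odd_of_sum_odd _ _ h
      match w, hw with
      | x :: y :: t, hw =>
        refine ⟨_, .word N (.vertex [] x (y :: t)), ?_⟩
        simp only [forestValue_pair, parity, Multiset.map_cons, Multiset.sum_cons,
          List.length_cons, List.length_nil] at hw h ⊢
        omega
    -- Deleting a vertex of degree 0 or 2 changes only the parity of the vertices. A path with an
    -- odd number of vertices has one: its only vertex, or the second one.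
    have heven : (M.map List.length).sum % 2 = 1 → ∃ q, Move (false, M) q ∧
        forestValue q.2 = 2 * ((M.map fun w => w.length - 1).sum % 2) := by
      intro h
      obtain ⟨w, N, rfl, hw⟩ := exists_odd_of_sum_odd _ _ h
      match w, hw with
      | [x], hw =>
        refine ⟨_, .word N (.vertex [] x []), ?_⟩
        simp only [forestValue_pair, parity, Multiset.map_cons, Multiset.sum_cons,
          List.length_cons, List.length_nil] at hw h ⊢
        omega
      | [x, y], hw => simp at hw
      | x :: y :: z :: t, hw =>
        refine ⟨_, .word N (.vertex [x] y (z :: t)), ?_⟩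
        simp only [forestValue_pair, parity, Multiset.map_cons, Multiset.sum_cons,
          List.length_cons, List.length_nil] at hw h ⊢
        omega
    change k < parity _ _ at hk
    unfold parity at hk
    rcases Nat.mod_two_eq_zero_or_one (M.map List.length).sum with hv | hv <;>
      rcases Nat.mod_two_eq_zero_or_one (M.map fun w => w.length - 1).sum with he | he <;>
      rw [hv, he] at hk
    · omega
    · rcases (by omega : k = 0 ∨ k = 1) with rfl | rfl
      · simpa [hv] using hedge he
      · simpa [Nat.add_mod, hv] using hend he
    · obtain rfl : k = 0 := by omega
      simpa [he] using heven hv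
    · rcases (by omega : k = 0 ∨ k = 1 ∨ k = 2) with rfl | rfl | rfl
      · simpa [Nat.add_mod, hv] using hend he
      · simpa [hv] using hedge he
      · simpa [he] using heven hv

/-! ### Spokeless components and reversal of paths. -/

theorem WordMove.true_notMem {b w P} (h : WordMove b w P) (hw : true ∉ w) :
    ∀ v ∈ P, true ∉ v := by
  cases h <;> simp_all

theorem WordMove.congr_hub {b b' w P} (h : WordMove b w P) (hw : true ∉ w) :
    WordMove b' w P := by
  cases h with
  | spoke p q hb => simp at hw
  | cut p q h1 h2 => exact .cut p q h1 h2
  | vertex p x q => exact .vertex p x q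

/-- Paths without spokes are separate components. -/
theorem value_add_forest (b : Bool) (M Z : Multiset (List Bool)) (hZ : ∀ w ∈ Z, true ∉ w) :
    value b (M + Z) = value b M ^^^ forestValue Z := by
  have hstep : ∀ {b w P} {Z : Multiset (List Bool)}, (∀ v ∈ w ::ₘ Z, true ∉ v) →
      WordMove b w P → ∀ v ∈ P + Z, true ∉ v := by
    intro b w P Z hZ h v hv
    rcases Multiset.mem_add.1 hv with hv | hv
    · exact h.true_notMem (hZ w (Multiset.mem_cons_self w Z)) v hv
    · exact hZ v (Multiset.mem_cons_of_mem hv)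
  rw [← value_false]
  -- The second summand carries the flag `false`, so that the hub is counted only once. Its moves do
  -- not depend on the flag, because `Z` has no spokes.
  refine isGrundy_value.eq_of_simulation (isGrundy_value.sum isGrundy_value) size Move.size_lt
    (fun x y => ∃ b M Z, (∀ w ∈ Z, true ∉ w) ∧ x = (b, M + Z) ∧ y = ((b, M), (false, Z)))
    ?_ ?_ (p := (b, M + Z)) (q := ((b, M), (false, Z))) ⟨b, M, Z, hZ, rfl, rfl⟩
  · rintro _ _ ⟨b, M, Z, hZ, rfl, rfl⟩ _ (⟨h⟩ | ⟨h⟩)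
    · rcases h with ⟨M⟩ | ⟨M, h⟩
      · exact ⟨_, .hub _, _, _, _, hZ, rfl, rfl⟩
      · rw [Multiset.cons_add]
        exact ⟨_, .word _ h, _, _, _, hZ, by rw [add_assoc], rfl⟩
    · rcases h with _ | ⟨Z, h⟩
      rw [Multiset.add_cons]
      exact ⟨_, .word _ (h.congr_hub (hZ _ (Multiset.mem_cons_self _ _))), _, M, _,
        hstep hZ h, by rw [add_left_comm], rfl⟩
  · rintro _ _ ⟨b, M, Z, hZ, rfl, rfl⟩ p' hp'
    left
    generalize hN : M + Z = N at hp'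
    rcases hp' with ⟨N⟩ | ⟨N, h⟩
    · subst hN
      exact ⟨_, .left (.hub _), _, _, _, hZ, rfl, rfl⟩
    · rcases cons_eq_add hN.symm with ⟨M', rfl, rfl⟩ | ⟨Z', rfl, rfl⟩
      · exact ⟨_, .left (.word _ h), _, _, _, hZ, by rw [add_assoc], rfl⟩
      · exact ⟨_, .right (.word _ (h.congr_hub (hZ _ (Multiset.mem_cons_self _ _)))), _, M, _,
          hstep hZ h, by rw [add_left_comm], rfl⟩

theorem WordMove.reverse {b w P} (h : WordMove b w P) :
    WordMove b w.reverse (P.map List.reverse) := by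
  cases h with
  | spoke p q hb => simpa using WordMove.spoke q.reverse p.reverse hb
  | cut p q h1 h2 =>
    have := WordMove.cut (b := b) q.reverse p.reverse (by simpa using h2) (by simpa using h1)
    rw [Multiset.pair_comm] at this
    simpa using this
  | vertex p x q =>
    have := WordMove.vertex (b := b) q.reverse x p.reverse
    rw [Multiset.pair_comm] at this
    simpa using this

/-- Paths may be reversed. -/
theorem value_reverse (b : Bool) (A C : Multiset (List Bool)) :
    value b (A + C) = value b (A.map List.reverse + C) := by
  refine isGrundy_value.eq_of_simulation isGrundy_value size Move.size_lt
    (fun x y => ∃ b A C, x = (b, A + C) ∧ y = (b, A.map List.reverse + C)) ?_ ?_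
    (p := (b, A + C)) (q := (b, A.map List.reverse + C)) ⟨b, A, C, rfl, rfl⟩
  · rintro _ _ ⟨b, A, C, rfl, rfl⟩ q' hq'
    generalize hN : A.map List.reverse + C = N at hq'
    rcases hq' with ⟨N⟩ | @⟨_, w, P, N, h⟩
    · subst hN
      exact ⟨_, .hub _, _, _, _, rfl, rfl⟩
    · rcases cons_eq_add hN.symm with ⟨A', hA, rfl⟩ | ⟨C', rfl, rfl⟩
      · obtain ⟨B, rfl⟩ : ∃ B, B.map List.reverse = A' := ⟨A'.map List.reverse, by simp⟩
        have hA' : A = w.reverse ::ₘ B := by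
          apply Multiset.map_injective List.reverse_injective
          rw [hA, Multiset.map_cons, List.reverse_reverse]
        subst hA'
        rw [Multiset.cons_add]
        refine ⟨_, .word _ h.reverse, _, _ + B, C, by rw [add_assoc], ?_⟩
        simp [add_assoc]
      · rw [Multiset.add_cons]
        refine ⟨_, .word _ h, _, A, _, by rw [add_left_comm], by rw [add_left_comm]⟩
  · rintro _ _ ⟨b, A, C, rfl, rfl⟩ p' hp'
    left
    generalize hN : A + C = N at hp'
    rcases hp' with ⟨N⟩ | ⟨N, h⟩
    · subst hN
      exact ⟨_, .hub _, _, _, _, rfl, rfl⟩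
    · rcases cons_eq_add hN.symm with ⟨A', rfl, rfl⟩ | ⟨C', rfl, rfl⟩
      · rw [Multiset.map_cons, Multiset.cons_add]
        refine ⟨_, .word _ h.reverse, _, _ + A', C, by rw [add_assoc], ?_⟩
        simp [add_assoc]
      · rw [Multiset.add_cons]
        refine ⟨_, .word _ h, _, A, _, by rw [add_left_comm], by rw [add_left_comm]⟩

/-! ### Mirror play inside a position: palindromes and cancelling pairs. -/

theorem append_cons_eq_append_cons {γ : Type*} {p q u v : List γ} {x c : γ}
    (h : p ++ x :: q = u ++ c :: v) :
    (∃ d, u = p ++ x :: d ∧ q = d ++ c :: v) ∨ (p = u ∧ x = c ∧ q = v) ∨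
      ∃ d, p = u ++ c :: d ∧ v = d ++ x :: q := by
  rcases List.append_eq_append_iff.1 h with ⟨d, rfl, h⟩ | ⟨d, rfl, h⟩
  · cases d with
    | nil => simp at h; simp [h]
    | cons y d => simp at h; obtain ⟨rfl, rfl⟩ := h; exact .inl ⟨d, rfl, rfl⟩
  · cases d with
    | nil => simp at h; simp [h]
    | cons y d => simp at h; obtain ⟨rfl, rfl⟩ := h; exact .inr (.inr ⟨d, rfl, rfl⟩)

theorem append_eq_append_cons {γ : Type*} {p q u v : List γ} {c : γ}
    (h : p ++ q = u ++ c :: v) :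
    (∃ d, u = p ++ d ∧ q = d ++ c :: v) ∨ ∃ d, p = u ++ c :: d ∧ v = d ++ q := by
  rcases List.append_eq_append_iff.1 h with ⟨d, rfl, h'⟩ | ⟨d, rfl, h'⟩
  · exact .inl ⟨d, rfl, h'⟩
  · cases d with
    | nil => exact .inl ⟨[], by simp, h'.symm⟩
    | cons y d => simp at h'; obtain ⟨rfl, rfl⟩ := h'; exact .inr ⟨d, rfl, rfl⟩

/-- The part of a mirror symmetric position that is fixed by the reflection, together with what
it amounts to. -/
inductive Core : Multiset (List Bool) → Multiset (List Bool) → Prop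
  | palindrome (u : List Bool) (c : Bool) : Core {u ++ c :: u.reverse} {[c]}
  | zero : Core 0 0
  -- This is what deleting the centre produces: the single vertex `[c]` leaves two empty words,
  -- while the two halves of the palindrome go into a mirror pair.
  | empty : Core 0 {[], []}

/-- A collection of paths together with its mirror image. -/
def double (A : Multiset (List Bool)) : Multiset (List Bool) := A + A.map List.reverse

theorem double_add (A B : Multiset (List Bool)) : double (A + B) = double A + double B := by
  simp [double, add_add_add_comm]

/-- A move in the reduced vertex is copied at the centre of the palindrome. `A` collects the two
halves if the centre vertex is deleted. -/
theorem Core.exists_move {b N K K'} (h : Core N K) (M : Multiset (List Bool))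
    (hK : ∃ w, K = {w} ∧ WordMove b w K') :
    ∃ N' A, Move (b, N + M) (b, N' + double A + M) ∧ Core N' K' := by
  obtain ⟨w, hw, hm⟩ := hK
  cases h with
  | zero => simp at hw
  | empty => have := congrArg Multiset.card hw; simp at this
  | palindrome u c =>
    obtain rfl : [c] = w := by simpa using hw
    generalize hc : [c] = w at hm
    cases hm with
    | spoke p q hb =>
      obtain ⟨rfl, rfl, rfl⟩ : p = [] ∧ c = true ∧ q = [] := by
        cases p <;> simp_all
      refine ⟨_, 0, ?_, .palindrome u false⟩
      have := Move.word M (WordMove.spoke u u.reverse hb)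
      simpa [double] using this
    | cut p q h1 h2 =>
      rcases p with _ | ⟨x, p⟩
      · exact absurd rfl h1
      · simp_all
    | vertex p x q =>
      obtain ⟨rfl, rfl, rfl⟩ : p = [] ∧ c = x ∧ q = [] := by
        cases p <;> simp_all
      refine ⟨0, {u}, ?_, .empty⟩
      have := Move.word M (WordMove.vertex (b := b) u c u.reverse)
      simpa [double] using this

/-- The reply to a move in a palindrome of odd length. -/
theorem wordMove_palindrome {b u c P} (h : WordMove b (u ++ c :: u.reverse) P) :
    (∃ K N A, WordMove b [c] K ∧ Core N K ∧ P = N + double A) ∨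
      ∃ w P₀ P₁ u' A, P = w ::ₘ P₀ ∧ WordMove b w P₁ ∧
        P₁ + P₀ = {u' ++ c :: u'.reverse} + double A := by
  generalize hw : u ++ c :: u.reverse = w at h
  cases h with
  | spoke p q hb =>
    -- The spoke lies left of the centre, at the centre, or right of it. In the outer cases removing
    -- the mirror spoke restores a palindrome.
    rcases append_cons_eq_append_cons hw.symm with ⟨d, rfl, rfl⟩ | ⟨rfl, rfl, rfl⟩ | ⟨d, rfl, hd⟩
    · right
      refine ⟨_, 0, _, p ++ false :: d, 0, rfl,
        by simpa using WordMove.spoke (p ++ false :: d ++ c :: d.reverse) p.reverse hb, ?_⟩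
      simp [double]
    · left
      exact ⟨_, _, 0, .spoke [] [] hb, .palindrome p false, by simp [double]⟩
    · right
      obtain rfl : u = q.reverse ++ true :: d.reverse := by simpa using congrArg List.reverse hd
      refine ⟨_, 0, _, q.reverse ++ false :: d.reverse, 0, rfl,
        by simpa using WordMove.spoke q.reverse (d.reverse ++ c :: (d ++ false :: q)) hb, ?_⟩
      simp [double]
  | cut p q h1 h2 =>
    -- With an odd number of vertices no path edge is fixed by the reflection, so a cut has no
    -- central case. The mirror cut isolates a shorter palindrome between two mirror pieces.
    rcases append_eq_append_cons hw.symm with ⟨d, rfl, rfl⟩ | ⟨d, rfl, hd⟩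
    · right
      refine ⟨_, _, _, d, {p}, Multiset.pair_comm _ _,
        by simpa using WordMove.cut (d ++ c :: d.reverse) p.reverse (by simp) (by simpa using h1),
        ?_⟩
      simp only [double, Multiset.map_singleton,
        ← Multiset.singleton_add]
      abel
    · right
      obtain rfl : u = q.reverse ++ d.reverse := by simpa using congrArg List.reverse hd
      refine ⟨_, _, _, d.reverse, {q}, rfl,
        by simpa using WordMove.cut q.reverse (d.reverse ++ c :: d) (by simpa using h2) (by simp),
        ?_⟩
      simp only [double, Multiset.map_singleton,
        ← Multiset.singleton_add, List.reverse_reverse]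
      abel
  | vertex p x q =>
    rcases append_cons_eq_append_cons hw.symm with ⟨d, rfl, rfl⟩ | ⟨rfl, rfl, rfl⟩ | ⟨d, rfl, hd⟩
    · right
      refine ⟨_, _, _, d, {p}, Multiset.pair_comm _ _,
        by simpa using WordMove.vertex (d ++ c :: d.reverse) x p.reverse, ?_⟩
      simp only [double, Multiset.map_singleton,
        ← Multiset.singleton_add]
      abel
    · left
      exact ⟨_, _, {p}, .vertex [] x [], .empty, by simp [double]⟩
    · right
      obtain rfl : u = q.reverse ++ x :: d.reverse := by simpa using congrArg List.reverse hd
      refine ⟨_, _, _, d.reverse, {q}, rfl,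
        by simpa using WordMove.vertex q.reverse x (d.reverse ++ c :: d), ?_⟩
      simp only [double, Multiset.map_singleton,
        ← Multiset.singleton_add, List.reverse_reverse]
      abel

theorem exists_move_double {b w P A} (h : WordMove b w P) (M : Multiset (List Bool)) :
    Move (b, P + (M + w.reverse ::ₘ A)) (b, M + A + double P) ∧
    Move (b, P.map List.reverse + (M + w ::ₘ A)) (b, M + A + double P) := by
  constructor
  · have := Move.word (P + (M + A)) h.reverse
    convert this using 2
    · simp
    · simp only [double]; abel
  · have := Move.word (P.map List.reverse + (M + A)) h
    convert this using 2
    · simp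
    · simp only [double]; abel

/-- A move in one half of `double A`, or off the centre of the palindrome, is answered by its
reflection and leaves `K` and `M` untouched. Moves at the hub, at the centre and in `M` correspond
to moves in `K + M`. This is the situation of `IsGrundy.eq_of_simulation`. -/
theorem value_core {N K} (hNK : Core N K) (b : Bool) (A M : Multiset (List Bool)) :
    value b (N + double A + M) = value b (K + M) := by
  refine isGrundy_value.eq_of_simulation isGrundy_value size Move.size_lt
    (fun x y => ∃ b A M N K, Core N K ∧ x = (b, N + double A + M) ∧ y = (b, K + M)) ?_ ?_
    (p := (b, N + double A + M)) (q := (b, K + M)) ⟨b, A, M, N, K, hNK, rfl, rfl⟩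
  · rintro _ _ ⟨b, A, M, N, K, hNK, rfl, rfl⟩ q' hq'
    generalize hX : K + M = X at hq'
    rcases hq' with ⟨X⟩ | @⟨_, w, P, X, h⟩
    · subst hX
      exact ⟨_, .hub _, _, _, _, _, _, hNK, rfl, rfl⟩
    · rcases cons_eq_add hX.symm with ⟨K', rfl, rfl⟩ | ⟨M', rfl, rfl⟩
      -- `K` has at most one word, or consists of two empty words, in which no move is possible.
      · have hK' : K' = 0 ∨ w = [] := by
          generalize hK : w ::ₘ K' = K at hNK
          cases hNK with
          | palindrome u c =>
            left
            have := congrArg Multiset.card hK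
            simpa using this
          | zero => simp at hK
          | empty =>
            right
            have : w ∈ w ::ₘ K' := Multiset.mem_cons_self _ _
            rw [hK] at this
            simpa using this
        rcases hK' with rfl | rfl
        · obtain ⟨N', A', hm, hc⟩ := hNK.exists_move (double A + M) ⟨w, rfl, h⟩
          refine ⟨(b, N' + double A' + (double A + M)), by rw [add_assoc]; exact hm, b, A' + A, M,
            N', P, hc, ?_, by rw [zero_add]⟩
          rw [double_add]; congr 1; abel
        · generalize hw : ([] : List Bool) = w at h
          cases h with
          | spoke p q hb => simp at hw
          | cut p q h1 h2 => exact absurd (List.append_eq_nil_iff.1 hw.symm).1 h1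
          | vertex p x q => simp at hw
      · rw [Multiset.add_cons]
        exact ⟨_, .word _ h, _, A, _, N, K, hNK, by rw [add_left_comm], by rw [add_left_comm]⟩
  · rintro _ _ ⟨b, A, M, N, K, hNK, rfl, rfl⟩ p' hp'
    generalize hX : N + double A + M = X at hp'
    rcases hp' with ⟨X⟩ | @⟨_, w, P, X, h⟩
    · subst hX
      exact .inl ⟨_, .hub _, _, _, _, _, _, hNK, rfl, rfl⟩
    · rcases cons_eq_add hX.symm with ⟨Y, hY, rfl⟩ | ⟨M', rfl, rfl⟩
      · rcases cons_eq_add hY.symm with ⟨N', rfl, rfl⟩ | ⟨D, hD, rfl⟩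
        · generalize hN : w ::ₘ N' = N at hNK
          cases hNK with
          | palindrome u c =>
            obtain ⟨rfl, rfl⟩ : w = u ++ c :: u.reverse ∧ N' = 0 := by
              have h1 := congrArg Multiset.card hN
              obtain rfl : N' = 0 := by simpa using h1
              exact ⟨by simpa using hN, rfl⟩
            rcases wordMove_palindrome h with ⟨K', N'', A', h1, h2, rfl⟩ |
              ⟨w', P₀, P₁, u', A', rfl, h1, h2⟩
            · left
              refine ⟨_, .word M h1, _, A' + A, M, N'', K', h2, ?_, rfl⟩
              rw [double_add]; congr 1; abel
            · right
              refine ⟨(b, P₁ + (P₀ + (0 + double A + M))), ?_, _, A' + A, M, _, _,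
                .palindrome u' c, ?_, rfl⟩
              · rw [Multiset.cons_add]
                exact .word _ h1
              · rw [← add_assoc, h2, double_add]; congr 1; abel
          | zero => simp at hN
          | empty => simp at hN
        · right
          rcases cons_eq_add (A := A) (B := A.map List.reverse) hD.symm with
            ⟨A', rfl, rfl⟩ | ⟨B, hB, rfl⟩
          · refine ⟨_, ?_, b, A' + P, M, N, K, hNK, rfl, rfl⟩
            have := (exists_move_double (A := A' + A'.map List.reverse) h (M + N)).1
            convert this using 2
            · simp only [Multiset.map_cons, Multiset.add_cons, Multiset.cons_add]
              congr 1; abel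
            · rw [double_add]; simp only [double]; abel
          · obtain ⟨A', rfl⟩ : ∃ A', A'.map List.reverse = B := ⟨B.map List.reverse, by simp⟩
            obtain rfl : A = w.reverse ::ₘ A' := by
              apply Multiset.map_injective List.reverse_injective
              rw [hB, Multiset.map_cons, List.reverse_reverse]
            refine ⟨_, ?_, b, A' + P, M, N, K, hNK, rfl, rfl⟩
            have := (exists_move_double (A := A' + A'.map List.reverse) h (M + N)).1
            convert this using 2
            · simp only [Multiset.add_cons, Multiset.cons_add]
              congr 1; abel
            · rw [double_add]; simp only [double]; abel
      · left
        rw [Multiset.add_cons]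
        exact ⟨_, .word _ h, _, A, _, N, K, hNK, by rw [add_left_comm], by rw [add_left_comm]⟩

/-- A path that is a palindrome of odd length can be replaced by its central vertex. -/
theorem value_palindrome (b : Bool) (u : List Bool) (c : Bool) (M : Multiset (List Bool)) :
    value b ((u ++ c :: u.reverse) ::ₘ M) = value b ([c] ::ₘ M) := by
  simpa [double] using value_core (.palindrome u c) b 0 M

/-- Two equal paths cancel. -/
theorem value_cancel (b : Bool) (w : List Bool) (M : Multiset (List Bool)) :
    value b (w ::ₘ w ::ₘ M) = value b M := by
  have h1 := value_core .zero b {w} M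
  -- The mirror pair cancels a word against its reverse, so one of the two copies is turned round.
  have h2 := value_reverse b {w} (w ::ₘ M)
  simp [double] at h1 h2
  rw [h2, ← h1, Multiset.cons_swap]

/-! ### A table of values that is checked by evaluation in the kernel

The functions below are written with recursors, since these evaluate much faster in the kernel than
definitions by pattern matching. -/

local notation "ifb " b " then " x " else " y => Bool.rec y x b
local notation:35 a:36 " andb " b:35 => @Bool.rec (fun _ => Bool) false b a
local notation:30 a:31 " orb " b:30 => @Bool.rec (fun _ => Bool) b true a

/-- The number whose binary digits, from the lowest to the highest, are the letters of `w` and a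
final `1`. -/
def code : List Bool → ℕ
  | [] => 1
  | x :: w => 2 * code w + x.toNat

/-- The word with a given code of at most `n` letters. -/
def decode : ℕ → ℕ → List Bool
  | 0, _ => []
  | n + 1, c => bif Nat.ble c 1 then [] else Nat.beq (c % 2) 1 :: decode n (c / 2)

/-- A word, given by its length, its code and the code of its reverse. -/
structure CodedPath where
  len : ℕ
  code : ℕ
  rev : ℕ

namespace CodedPath

/-- The coded form of a word. -/
def ofWord (w : List Bool) : CodedPath :=
  ⟨w.length, GraphTakeAway.code w, GraphTakeAway.code w.reverse⟩

/-- The first `i` letters. -/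
def take (i : ℕ) (x : CodedPath) : CodedPath :=
  ⟨i, Nat.add (Nat.mod x.code (Nat.pow 2 i)) (Nat.pow 2 i),
    Nat.div x.rev (Nat.pow 2 (Nat.sub x.len i))⟩

/-- The word without its first `i` letters. -/
def drop (i : ℕ) (x : CodedPath) : CodedPath :=
  ⟨Nat.sub x.len i, Nat.div x.code (Nat.pow 2 i),
    Nat.add (Nat.mod x.rev (Nat.pow 2 (Nat.sub x.len i))) (Nat.pow 2 (Nat.sub x.len i))⟩

/-- Remove the spoke at the `i`-th vertex. -/
def clear (i : ℕ) (x : CodedPath) : CodedPath :=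
  ⟨x.len, Nat.sub x.code (Nat.pow 2 i), Nat.sub x.rev (Nat.pow 2 (Nat.sub x.len (Nat.succ i)))⟩

/-- The `i`-th letter. -/
def letter (i : ℕ) (x : CodedPath) : Bool :=
  Nat.beq (Nat.mod (Nat.div x.code (Nat.pow 2 i)) 2) 1

/-- Whether the `i`-th vertex has odd degree. -/
def oddDegree (i : ℕ) (x : CodedPath) : Bool :=
  ifb Nat.beq i 0 then (ifb Nat.beq x.len 1 then x.letter i else not (x.letter i))
  else ifb Nat.beq (Nat.succ i) x.len then not (x.letter i) else x.letter i

/-- Some move at the first `n` vertices of a path in the presence of the hub leads to paths that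
satisfy `k`. The flags tell whether to consider deletions of edges, of vertices of even degree, and
of vertices of odd degree. -/
def anyBelow (e v₀ v₁ : Bool) (x : CodedPath) (k : List CodedPath → Bool) (n : ℕ) : Bool :=
  @Nat.rec (fun _ => Bool) false (fun i ih =>
    ((ifb x.oddDegree i then v₁ else v₀) andb k [x.take i, x.drop (Nat.succ i)]) orb
    (e andb ((x.letter i andb k [x.clear i]) orb (Nat.ble 1 i andb k [x.take i, x.drop i]))) orb
      ih) n

/-- The path or its reverse, whichever has the smaller code. -/
def canonical (x : CodedPath) : CodedPath :=
  ifb Nat.ble x.code x.rev then x else ⟨x.len, x.rev, x.code⟩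

/-- Insert a path into a list sorted by code, where equal paths cancel. -/
def toggle (x : CodedPath) (L : List CodedPath) : List CodedPath :=
  @List.rec CodedPath (fun _ => List CodedPath) [x] (fun y L ih =>
    ifb Nat.beq x.code y.code then L else ifb Nat.ble x.code y.code then x :: y :: L else y :: ih) L

/-- Add a path to a normalized list of paths, with the value of the components that were split
off. -/
def add (x : CodedPath) (s : List CodedPath × ℕ) : List CodedPath × ℕ :=
  ifb Nat.beq x.code (Nat.pow 2 x.len) then
    (s.1, Nat.xor s.2 (parity x.len (Nat.sub x.len 1)))
  else ifb Nat.beq (Nat.mod x.len 2) 1 andb Nat.beq x.code x.rev then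
    -- `⟨1, 3, 3⟩` is the coded word `[true]`; without a spoke the central vertex is an isolated
    -- vertex, of value 1.
    ifb x.letter (Nat.div x.len 2) then (toggle ⟨1, 3, 3⟩ s.1, s.2) else (s.1, Nat.xor s.2 1)
  else (toggle x.canonical s.1, s.2)

/-- Add the paths in `M` to a normalized list of paths. -/
def addAll (M : List CodedPath) (s : List CodedPath × ℕ) : List CodedPath × ℕ :=
  @List.rec CodedPath (fun _ => List CodedPath × ℕ) s (fun x _ ih => x.add ih) M

/-- Some move in a list of paths leads to a position whose normal form satisfies `k`. The paths in
`L` are not touched. -/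
def anyMove (e v₀ v₁ : Bool) (k : List CodedPath × ℕ → Bool) (M : List CodedPath) :
    List CodedPath → Bool :=
  @List.rec CodedPath (fun _ => List CodedPath → Bool) (fun _ => false) (fun x M ih L =>
    (anyBelow e v₀ v₁ x (fun P => k (addAll P (addAll L (addAll M ([], 0))))) x.len) orb
      ih (x :: L)) M

/-- The value after the deletion of the hub. -/
def hubValue (M : List CodedPath) : ℕ :=
  parity (@List.rec CodedPath (fun _ => ℕ) 0 (fun x _ n => Nat.add x.len n) M)
    (@List.rec CodedPath (fun _ => ℕ) 0 (fun x _ n => Nat.add (Nat.sub x.len 1) n) M)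

/-- The codes of a list of paths, packed into a number. -/
def pack (M : List CodedPath) : ℕ :=
  -- The base is `2 ^ 25`, which exceeds every code of a word with at most 24 letters. Codes are
  -- positive, so a zero quotient marks the end of the list.
  @List.rec CodedPath (fun _ => ℕ) 0 (fun x _ k => Nat.add x.code (Nat.mul 33554432 k)) M

end CodedPath

/-- The list of codes packed into a number. -/
def unpack : ℕ → ℕ → List ℕ
  | 0, _ => []
  | n + 1, k => bif Nat.beq k 0 then [] else k % 33554432 :: unpack n (k / 33554432)

/-- Comparison of a list of codes with the codes of a list of paths. -/
def beqCodes : List ℕ → List CodedPath → Bool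
  | [], [] => true
  | c :: M, x :: N => Nat.beq c x.code && beqCodes M N
  | _, _ => false

/-- A search tree that assigns values to positions, which are given by their packed codes. -/
inductive Table
  | leaf
  | node (l : Table) (key val : ℕ) (r : Table)

namespace Table

open CodedPath

/-- The value that is stored for the key `k`. -/
noncomputable def find (k : ℕ) (T : Table) : Option ℕ :=
  @Table.rec (fun _ => Option ℕ) none (fun _ key val _ l r => ifb Nat.beq k key then some val else
    ifb Nat.ble k key then l else r) T

/-- The value of the normal form `s` is known and satisfies `p`. -/
noncomputable def holds (T : Table) (p : ℕ → Bool) (s : List CodedPath × ℕ) : Bool :=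
  @Option.rec ℕ (fun _ => Bool) false (fun v => p (Nat.xor v s.2) andb
    beqCodes (unpack 12 (pack s.1)) s.1) (T.find (pack s.1))

/-- Some option visibly has value `y`. The flags select the options that are considered first. -/
noncomputable def hasOption (T : Table) (e v₀ v₁ : Bool) (M : List CodedPath) (y : ℕ) : Bool :=
  Nat.beq (hubValue M) y orb anyMove e v₀ v₁ (T.holds (Nat.beq y)) M [] orb
    anyMove (not e) (not v₀) (not v₁) (T.holds (Nat.beq y)) M []

/-- It is not visible that the value differs from `v`. -/
noncomputable def maybe (T : Table) (e v₀ v₁ : Bool) (v : ℕ) (s : List CodedPath × ℕ) : Bool :=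
  ifb T.holds (fun y => not (Nat.beq y v)) s then false else
    not (T.hasOption e v₀ v₁ s.1 (Nat.xor v s.2))

/-- The value is visibly equal to `v`. -/
noncomputable def check (T : Table) (M : List CodedPath) (v : ℕ) : Bool :=
  ifb Nat.beq (hubValue M) v then false else
  -- The three passes together cover all moves except the deletion of the hub. They are separated
  -- only so that replies of the same kind as the move are tried first.
  ifb anyMove true false false (T.maybe true false false v) M [] then false else
  ifb anyMove false true false (T.maybe false true false v) M [] then false else
  ifb anyMove false false true (T.maybe false false true v) M [] then false else
  (List.range v).all (T.hasOption true true true M)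

/-- The paths of an entry. -/
def paths (key : ℕ) : List CodedPath := (unpack 12 key).map fun c => .ofWord (decode 25 c)

/-- All entries of the second table can be verified with the help of the first one. -/
noncomputable def checkAll (T : Table) : Table → Bool
  | .leaf => true
  | .node l key val r => (beqCodes (unpack 12 key) (paths key) andb
      T.check (paths key) val) andb T.checkAll l andb T.checkAll r

end Table

/-! ### Correctness of the operations on coded paths. -/

theorem rec_eq_cond {γ : Type*} (b : Bool) (x y : γ) :
    @Bool.rec (fun _ => γ) y x b = bif b then x else y := by cases b <;> rfl

theorem two_pow_le_code (w : List Bool) : 2 ^ w.length ≤ code w := by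
  induction w with
  | nil => simp [code]
  | cons x w ih => simp only [code, List.length_cons, pow_succ]; omega

theorem code_lt (w : List Bool) : code w < 2 * 2 ^ w.length := by
  induction w with
  | nil => simp [code]
  | cons x w ih =>
    have := x.toNat_le
    simp only [code, List.length_cons, pow_succ]; omega

/-- The final digit `1` of `code p` sits at place `p.length`, where the digits of `q` begin in the
concatenation; adding `2 ^ p.length` on the left avoids subtraction. The formulas for prefixes and
suffixes follow. -/
theorem code_append (p q : List Bool) :
    code (p ++ q) + 2 ^ p.length = code p + 2 ^ p.length * code q := by
  induction p with
  | nil => simp [code]; omega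
  | cons x p ih =>
    simp only [code, List.length_cons, List.cons_append, pow_succ]
    linarith

theorem code_injective : Function.Injective code := by
  intro v w h
  induction v generalizing w with
  | nil =>
    cases w with
    | nil => rfl
    | cons x w =>
      have := two_pow_le_code w
      have := Nat.one_le_two_pow (n := w.length)
      simp only [code] at h
      omega
  | cons y v ih =>
    have h1 := two_pow_le_code v
    have h2 := Nat.one_le_two_pow (n := v.length)
    cases w with
    | nil =>
      simp only [code] at h
      omega
    | cons x w =>
      simp only [code] at h
      have h3 := x.toNat_le
      have h4 := y.toNat_le
      have h5 : y.toNat = x.toNat := by omega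
      rw [ih (by omega : code v = code w)]
      cases x <;> cases y <;> simp_all

theorem true_notMem_of_code {w : List Bool} (h : code w = 2 ^ w.length) : true ∉ w := by
  induction w with
  | nil => simp
  | cons x w ih =>
    have h1 := two_pow_le_code w
    simp only [code, List.length_cons, pow_succ] at h
    have h2 : x = false := Bool.toNat_eq_zero.1 (by omega)
    simp [h2, ih (by omega)]

theorem code_mod (p q : List Bool) :
    code (p ++ q) % 2 ^ p.length + 2 ^ p.length = code p := by
  have h1 := code_append p q
  have h2 := two_pow_le_code p
  have h3 := code_lt p
  have h4 : code (p ++ q) = code p - 2 ^ p.length + 2 ^ p.length * code q := by omega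
  rw [h4, Nat.add_mul_mod_self_left, Nat.mod_eq_of_lt (by omega)]
  omega

theorem code_div (p q : List Bool) : code (p ++ q) / 2 ^ p.length = code q := by
  have h1 := code_append p q
  have h2 := two_pow_le_code p
  have h3 := code_lt p
  have h4 : code (p ++ q) = code p - 2 ^ p.length + 2 ^ p.length * code q := by omega
  rw [h4, Nat.add_mul_div_left _ _ (by positivity), Nat.div_eq_of_lt (by omega), zero_add]

theorem nat_div_eq (a b : ℕ) : Nat.div a b = a / b := rfl

theorem nat_mod_eq (a b : ℕ) : Nat.mod a b = a % b := rfl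

namespace CodedPath

theorem take_ofWord (p q : List Bool) : (ofWord (p ++ q)).take p.length = ofWord p := by
  have h1 := code_mod p q
  have h2 := code_div q.reverse p.reverse
  rw [List.length_reverse] at h2
  simp only [ofWord, take, List.length_append, List.reverse_append, Nat.add_eq, nat_mod_eq,
    Nat.pow_eq, nat_div_eq, Nat.sub_eq, Nat.add_sub_cancel_left, h1, h2]

theorem drop_ofWord (p q : List Bool) : (ofWord (p ++ q)).drop p.length = ofWord q := by
  have h1 := code_mod q.reverse p.reverse
  have h2 := code_div p q
  rw [List.length_reverse] at h1
  simp only [ofWord, drop, List.length_append, List.reverse_append, Nat.add_eq, nat_mod_eq,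
    Nat.pow_eq, nat_div_eq, Nat.sub_eq, Nat.add_sub_cancel_left, h1, h2]

theorem letter_ofWord (p : List Bool) (x : Bool) (q : List Bool) :
    (ofWord (p ++ x :: q)).letter p.length = x := by
  have h1 := code_div p (x :: q)
  simp only [ofWord, letter, nat_mod_eq, Nat.pow_eq, nat_div_eq, h1, GraphTakeAway.code]
  cases x
  · simp; rfl
  · simp

theorem clear_ofWord (p q : List Bool) :
    (ofWord (p ++ true :: q)).clear p.length = ofWord (p ++ false :: q) := by
  have h1 := code_append p (true :: q)
  have h2 := code_append p (false :: q)
  have h3 := code_append q.reverse (true :: p.reverse)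
  have h4 := code_append q.reverse (false :: p.reverse)
  simp only [GraphTakeAway.code, Bool.toNat_true, Bool.toNat_false, mul_add, mul_one, add_zero,
    List.length_reverse] at h1 h2 h3 h4
  simp only [ofWord, clear, List.length_append, List.reverse_append, Nat.pow_eq, Nat.sub_eq,
    List.length_cons, List.reverse_cons, List.append_assoc, List.singleton_append,
    CodedPath.mk.injEq, true_and, Nat.succ_eq_add_one]
  rw [show p.length + (q.length + 1) - (p.length + 1) = q.length by omega]
  omega

theorem exists_of_anyBelow {e v₀ v₁ : Bool} {w : List Bool} {k : List CodedPath → Bool} {n : ℕ}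
    (hn : n ≤ w.length) (h : anyBelow e v₀ v₁ (ofWord w) k n = true) :
    ∃ P : List (List Bool), WordMove true w P ∧ k (P.map ofWord) = true := by
  induction n with
  | zero => cases h
  | succ i ih =>
    obtain ⟨p, x, q, rfl, rfl⟩ : ∃ p x q, w = p ++ x :: q ∧ p.length = i :=
      ⟨w.take i, w[i], w.drop (i + 1), by simp, by simp; omega⟩
    have h1 : (ofWord (p ++ x :: q)).drop (Nat.succ p.length) = ofWord q := by
      simpa using drop_ofWord (p ++ [x]) q
    simp only [anyBelow, rec_eq_cond, Bool.cond_false_right, Bool.cond_true_left] at h ih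
    rw [take_ofWord, h1, letter_ofWord, drop_ofWord] at h
    simp only [Bool.or_eq_true, Bool.and_eq_true] at h
    rcases h with ⟨-, h⟩ | ⟨-, ⟨hx, h⟩ | ⟨hp, h⟩⟩ | h
    · exact ⟨[p, q], .vertex p x q, h⟩
    · subst hx
      rw [clear_ofWord] at h
      exact ⟨[p ++ false :: q], .spoke p q rfl, h⟩
    · exact ⟨[p, x :: q], .cut p (x :: q) (List.length_pos_iff.1 (Nat.le_of_ble_eq_true hp))
        (by simp), h⟩
    · exact ih (by omega) h

theorem anyBelow_false {e v₀ v₁ : Bool} {x : CodedPath} {k : List CodedPath → Bool} {n i : ℕ}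
    (h : anyBelow e v₀ v₁ x k n = false) (hi : i < n) :
    ((bif x.oddDegree i then v₁ else v₀) = true → k [x.take i, x.drop (i + 1)] = false) ∧
    (e = true → x.letter i = true → k [x.clear i] = false) ∧
    (e = true → 1 ≤ i → k [x.take i, x.drop i] = false) := by
  induction n with
  | zero => omega
  | succ n ih =>
    simp only [anyBelow, rec_eq_cond, Bool.cond_false_right, Bool.cond_true_left,
      Bool.or_eq_false_iff, Bool.and_eq_false_imp] at h ih
    rcases Nat.lt_succ_iff_lt_or_eq.1 hi with hi | rfl
    · exact ih h.2.2 hi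
    · exact ⟨h.1, fun he => (h.2.1 he).1, fun he h1 => (h.2.1 he).2 (Nat.ble_eq_true_of_le h1)⟩

theorem eq_false_of_anyBelow {w : List Bool} {k : List CodedPath → Bool}
    (h₁ : anyBelow true false false (ofWord w) k w.length = false)
    (h₂ : anyBelow false true false (ofWord w) k w.length = false)
    (h₃ : anyBelow false false true (ofWord w) k w.length = false)
    {Q : Multiset (List Bool)} (hQ : WordMove true w Q) :
    ∃ P : List (List Bool), Q = P ∧ k (P.map ofWord) = false := by
  cases hQ with
  | spoke p q hb =>
    have := (anyBelow_false (i := p.length) h₁ (by simp)).2.1 rfl (letter_ofWord p true q)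
    rw [clear_ofWord] at this
    exact ⟨[p ++ false :: q], rfl, this⟩
  | cut p q hp hq =>
    have := (anyBelow_false (i := p.length) h₁
      (by simpa using List.length_pos_iff.2 hq)).2.2 rfl (List.length_pos_iff.2 hp)
    rw [take_ofWord, drop_ofWord] at this
    exact ⟨[p, q], rfl, this⟩
  | vertex p x q =>
    refine ⟨[p, q], rfl, ?_⟩
    have h1 : (ofWord (p ++ x :: q)).drop (p.length + 1) = ofWord q := by
      simpa using drop_ofWord (p ++ [x]) q
    have h4 := (anyBelow_false (i := p.length) h₂ (by simp)).1
    have h5 := (anyBelow_false (i := p.length) h₃ (by simp)).1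
    rw [take_ofWord, h1] at h4 h5
    -- The meaning of `oddDegree` plays no role: whichever value it takes, one of the two vertex
    -- passes has examined this deletion.
    cases h6 : (ofWord (p ++ x :: q)).oddDegree p.length
    · exact h4 (by rw [h6]; rfl)
    · exact h5 (by rw [h6]; rfl)

/-- The sum of the sizes of the words in a list. -/
def _root_.GraphTakeAway.wordsSize (W : List (List Bool)) : ℕ := (W.map wordSize).sum

/-- The arbitrary surroundings `M` allow paths to be inserted one after another. The size bound
keeps normal forms within reach of the induction on size that justifies the table. -/
theorem toggle_ofWord (w : List Bool) (W : List (List Bool)) :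
    ∃ W' : List (List Bool), toggle (ofWord w) (W.map ofWord) = W'.map ofWord ∧
      (∀ M, value true (W' + M) = value true (w ::ₘ (W + M))) ∧
      wordsSize W' ≤ wordSize w + wordsSize W := by
  induction W with
  | nil => exact ⟨[w], rfl, fun M => by simp, by simp [wordsSize]⟩
  | cons v W ih =>
    simp only [toggle, List.map_cons, rec_eq_cond] at ih ⊢
    cases h1 : Nat.beq (ofWord w).code (ofWord v).code
    · cases h2 : Nat.ble (ofWord w).code (ofWord v).code
      · obtain ⟨W', h3, h4, h5⟩ := ih
        refine ⟨v :: W', by simp [h3], fun M => ?_, ?_⟩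
        · have := h4 (v ::ₘ M)
          simp only [Multiset.add_cons, ← Multiset.cons_coe, Multiset.cons_add] at this ⊢
          exact this
        · simp only [wordsSize, List.map_cons, List.sum_cons] at h5 ⊢
          omega
      · refine ⟨w :: v :: W, by simp, fun M => ?_, le_of_eq (by simp [wordsSize])⟩
        simp only [← Multiset.cons_coe, Multiset.cons_add]
    · obtain rfl := code_injective (Nat.eq_of_beq_eq_true h1)
      refine ⟨W, by simp, fun M => ?_, ?_⟩
      · simp only [← Multiset.cons_coe, Multiset.cons_add]
        rw [value_cancel]
      · simp only [wordsSize, List.map_cons, List.sum_cons]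
        omega

theorem exists_palindrome {w : List Bool} (hw : w.reverse = w) (hl : w.length % 2 = 1) :
    ∃ u c, w = u ++ c :: u.reverse ∧ u.length = w.length / 2 := by
  have hlt : w.length / 2 < w.length := by omega
  refine ⟨w.take (w.length / 2), w[w.length / 2], ?_, by simp; omega⟩
  conv_lhs => rw [← List.take_append_drop (w.length / 2) w]
  rw [List.drop_eq_getElem_cons hlt]
  rw [List.reverse_take, hw]
  congr 3
  omega

theorem wordSize_reverse (w : List Bool) : wordSize w.reverse = wordSize w := by
  simp [wordSize]

theorem value_reverse_cons (w : List Bool) (M : Multiset (List Bool)) :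
    value true (w.reverse ::ₘ M) = value true (w ::ₘ M) := by
  simpa using (value_reverse true {w} M).symm

/-- The three branches rest on `value_add_forest`, on `value_palindrome`, and on reversal followed
by cancellation. The number in `s` collects the nim-sum of the components that were split off. -/
theorem add_ofWord (w : List Bool) (W : List (List Bool)) (s : List CodedPath × ℕ)
    (hs : s.1 = W.map ofWord) :
    ∃ W' : List (List Bool), (add (ofWord w) s).1 = W'.map ofWord ∧
      (∀ M, value true (W' + M) ^^^ (add (ofWord w) s).2 = value true (w ::ₘ (W + M)) ^^^ s.2) ∧
      wordsSize W' ≤ wordSize w + wordsSize W := by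
  obtain ⟨L, x⟩ := s
  obtain rfl : L = W.map ofWord := hs
  have hsplit : ∀ (v : List Bool), true ∉ v → ∀ M, value true (v ::ₘ (W + M)) =
      value true (W + M) ^^^ parity v.length (v.length - 1) := by
    intro v hv M
    have := value_add_forest true (W + M) {v} (by simpa using hv)
    rw [← Multiset.singleton_add, add_comm, this]
    simp [forestValue]
  simp only [add, rec_eq_cond, Bool.cond_false_right]
  cases h1 : Nat.beq (ofWord w).code (Nat.pow 2 (ofWord w).len)
  · cases h2 : (Nat.beq (Nat.mod (ofWord w).len 2) 1 && Nat.beq (ofWord w).code (ofWord w).rev)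
    · obtain ⟨v, hv, h3⟩ : ∃ v, canonical (ofWord w) = ofWord v ∧ (v = w ∨ v = w.reverse) := by
        simp only [canonical, rec_eq_cond]
        cases Nat.ble (ofWord w).code (ofWord w).rev
        · exact ⟨w.reverse, by simp [ofWord], .inr rfl⟩
        · exact ⟨w, rfl, .inl rfl⟩
      obtain ⟨W', h4, h5, h6⟩ := toggle_ofWord v W
      refine ⟨W', by simp [hv, h4], fun M => ?_, ?_⟩
      · rcases h3 with rfl | rfl
        · simp [h5]
        · simp [h5, value_reverse_cons]
      · rcases h3 with rfl | rfl
        · exact h6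
        · rwa [wordSize_reverse] at h6
    · rw [Bool.and_eq_true] at h2
      have h3 : w.length % 2 = 1 := Nat.eq_of_beq_eq_true h2.1
      obtain ⟨u, c, hw, hu⟩ :=
        exists_palindrome (code_injective (Nat.eq_of_beq_eq_true h2.2)).symm h3
      have h4 : (ofWord w).letter (Nat.div (ofWord w).len 2) = c := by
        change (ofWord w).letter (w.length / 2) = c
        rw [← hu, hw, letter_ofWord]
      have h5 : ∀ M, value true (w ::ₘ M) = value true ([c] ::ₘ M) := by
        intro M
        rw [hw, value_palindrome]
      -- The replacement `[true]` has size 2, which must not exceed the size of the palindrome.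
      have h6 : c = true → 2 ≤ wordSize w := by
        rintro rfl
        rw [hw]
        simp [wordSize]
        omega
      rw [h4]
      cases c
      · refine ⟨W, by simp, fun M => ?_, by omega⟩
        rw [h5, hsplit [false] (by simp)]
        simp [parity, Nat.xor_comm, Nat.xor_left_comm]
      · obtain ⟨W', h7, h8, h9⟩ := toggle_ofWord [true] W
        refine ⟨W', by simpa [ofWord, GraphTakeAway.code] using h7, fun M => ?_, ?_⟩
        · simp [h5, h8]
        · have := h6 rfl
          have h10 : wordSize [true] = 2 := by simp [wordSize]
          omega
  · refine ⟨W, by simp, fun M => ?_, by omega⟩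
    rw [hsplit w (true_notMem_of_code (Nat.eq_of_beq_eq_true h1))]
    simp [ofWord, Nat.xor_comm, Nat.xor_left_comm]

/-- `s` is a normal form of the position `M`. -/
def Reduces (s : List CodedPath × ℕ) (M : Multiset (List Bool)) : Prop :=
  ∃ W : List (List Bool), s.1 = W.map ofWord ∧ value true W ^^^ s.2 = value true M ∧
    size (true, (W : Multiset (List Bool))) ≤ size (true, M)

theorem addAll_ofWord (V W : List (List Bool)) (s : List CodedPath × ℕ)
    (hs : s.1 = W.map ofWord) :
    ∃ W' : List (List Bool), (addAll (V.map ofWord) s).1 = W'.map ofWord ∧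
      (∀ M, value true (W' + M) ^^^ (addAll (V.map ofWord) s).2 =
        value true (V + (W + M)) ^^^ s.2) ∧
      wordsSize W' ≤ wordsSize V + wordsSize W := by
  induction V with
  | nil => exact ⟨W, hs, fun M => by simp [addAll], by simp [wordsSize]⟩
  | cons v V ih =>
    obtain ⟨W₁, h1, h2, h3⟩ := ih
    obtain ⟨W₂, h4, h5, h6⟩ := add_ofWord v W₁ _ h1
    refine ⟨W₂, h4, fun M => ?_, ?_⟩
    · have := h2 (v ::ₘ M)
      rw [Multiset.add_cons, Multiset.add_cons, Multiset.add_cons, ← h5] at this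
      rw [← Multiset.cons_coe, Multiset.cons_add, ← this]
      rfl
    · simp only [wordsSize, List.map_cons, List.sum_cons] at h3 h6 ⊢
      omega

theorem reduces_addAll (U V W : List (List Bool)) :
    Reduces (addAll (U.map ofWord) (addAll (V.map ofWord) (addAll (W.map ofWord) ([], 0))))
      ((U : Multiset (List Bool)) + V + W) := by
  obtain ⟨W₁, h1, h2, h3⟩ := addAll_ofWord W [] ([], 0) rfl
  obtain ⟨W₂, h4, h5, h6⟩ := addAll_ofWord V W₁ _ h1
  obtain ⟨W₃, h7, h8, h9⟩ := addAll_ofWord U W₂ _ h4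
  refine ⟨W₃, h7, ?_, ?_⟩
  · have e1 := h8 0
    have e2 := h5 U
    have e3 := h2 (U + V)
    simp only [add_zero, Multiset.coe_nil, zero_add] at e1 e2 e3
    rw [e1, add_comm, e2, ← add_assoc, add_comm _ (U : Multiset (List Bool)), ← add_assoc,
      add_comm _ (W₁ : Multiset (List Bool)), e3, add_comm]
    simp
  · have e1 : ∀ X : List (List Bool), size (true, (X : Multiset (List Bool))) =
        1 + wordsSize X := fun X => by simp [size, wordsSize]
    have e2 : size (true, (U : Multiset (List Bool)) + V + W) =
        1 + (wordsSize U + wordsSize V + wordsSize W) := by simp [size, wordsSize, add_assoc]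
    rw [e1, e2]
    simp only [wordsSize, List.map_nil, List.sum_nil] at *
    omega

theorem exists_of_anyMove {e v₀ v₁ : Bool} {k : List CodedPath × ℕ → Bool}
    {W V : List (List Bool)} (h : anyMove e v₀ v₁ k (W.map ofWord) (V.map ofWord) = true) :
    ∃ N s, Move (true, (W : Multiset (List Bool)) + V) (true, N) ∧ Reduces s N ∧ k s = true := by
  induction W generalizing V with
  | nil => cases h
  | cons w W ih =>
    simp only [anyMove, rec_eq_cond, Bool.cond_true_left, List.map_cons, Bool.or_eq_true] at h ih
    rw [← Multiset.cons_coe, Multiset.cons_add]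
    rcases h with h | h
    · obtain ⟨P, h1, h2⟩ := exists_of_anyBelow le_rfl h
      refine ⟨_, _, .word _ h1, ?_, h2⟩
      have := reduces_addAll P V W
      rwa [add_assoc, add_comm (V : Multiset (List Bool))] at this
    · obtain ⟨N, s, h1, h2⟩ := ih (V := w :: V) h
      rw [← Multiset.cons_coe, Multiset.add_cons] at h1
      exact ⟨N, s, h1, h2⟩

theorem eq_false_of_anyMove {k₁ k₂ k₃ : List CodedPath × ℕ → Bool} {W V : List (List Bool)}
    (h₁ : anyMove true false false k₁ (W.map ofWord) (V.map ofWord) = false)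
    (h₂ : anyMove false true false k₂ (W.map ofWord) (V.map ofWord) = false)
    (h₃ : anyMove false false true k₃ (W.map ofWord) (V.map ofWord) = false)
    {w : List Bool} {N P : Multiset (List Bool)} (hP : WordMove true w P)
    (hN : w ::ₘ N = (W : Multiset (List Bool))) :
    ∃ s, Reduces s (P + N + V) ∧ (k₁ s && (k₂ s && k₃ s)) = false := by
  -- A search that fails for `k` fails for any stronger predicate. This replaces the three
  -- predicates by their conjunction, since it is not recorded which pass has seen the given move.
  have hk : ∀ {e v₀ v₁ : Bool} {k k' : List CodedPath → Bool} {x : CodedPath} {n : ℕ},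
      (∀ P, k' P = true → k P = true) → anyBelow e v₀ v₁ x k n = false →
      anyBelow e v₀ v₁ x k' n = false := by
    intro e v₀ v₁ k k' x n hkk h
    induction n with
    | zero => rfl
    | succ n ih =>
      have hkk' : ∀ P, k P = false → k' P = false := fun P hP => by
        by_contra hc
        rw [hkk P (by simpa using hc)] at hP
        cases hP
      simp only [anyBelow, rec_eq_cond, Bool.cond_false_right, Bool.cond_true_left,
        Bool.or_eq_false_iff, Bool.and_eq_false_imp] at h ih ⊢
      exact ⟨fun a => hkk' _ (h.1 a), fun a => ⟨fun b => hkk' _ ((h.2.1 a).1 b),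
        fun b => hkk' _ ((h.2.1 a).2 b)⟩, ih h.2.2⟩
  induction W generalizing V N with
  | nil => simp at hN
  | cons v W ih =>
    simp only [anyMove, rec_eq_cond, Bool.cond_true_left, List.map_cons,
      Bool.or_eq_false_iff] at h₁ h₂ h₃ ih
    by_cases hwv : w = v
    · subst hwv
      obtain rfl : N = W := by simpa [← Multiset.cons_coe] using hN
      obtain ⟨P, rfl, h⟩ := eq_false_of_anyBelow
        (k := fun P => let s := addAll P (addAll (V.map ofWord) (addAll (W.map ofWord) ([], 0)))
          k₁ s && (k₂ s && k₃ s))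
        (hk (by simp +contextual) h₁.1) (hk (by simp +contextual) h₂.1)
        (hk (by simp +contextual) h₃.1) hP
      refine ⟨_, ?_, h⟩
      have := reduces_addAll P V W
      rwa [add_assoc, add_comm (V : Multiset (List Bool)), ← add_assoc] at this
    · rw [← Multiset.cons_coe] at hN
      obtain ⟨N', hN', hW⟩ : ∃ N', N = v ::ₘ N' ∧ w ::ₘ N' = W := by
        rcases Multiset.cons_eq_cons.1 hN with ⟨h, -⟩ | ⟨-, N', h1, h2⟩
        · exact absurd h hwv
        · exact ⟨N', h1, h2.symm⟩
      obtain ⟨s, h1, h2⟩ := ih (V := v :: V) h₁.2 h₂.2 h₃.2 hW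
      refine ⟨s, ?_, h2⟩
      rw [hN', Multiset.add_cons, Multiset.cons_add]
      rwa [← Multiset.cons_coe, Multiset.add_cons] at h1

theorem hubValue_ofWord (W : List (List Bool)) : hubValue (W.map ofWord) = value false W := by
  rw [value_false]
  have h1 : ∀ W : List (List Bool), @List.rec CodedPath (fun _ => ℕ) 0
      (fun x _ n => Nat.add x.len n) (W.map ofWord) = (W.map List.length).sum := by
    intro W
    induction W with
    | nil => rfl
    | cons w W ih => simp only [List.map_cons, ih]; rfl
  have h2 : ∀ W : List (List Bool), @List.rec CodedPath (fun _ => ℕ) 0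
      (fun x _ n => Nat.add (Nat.sub x.len 1) n) (W.map ofWord) =
      (W.map fun w => w.length - 1).sum := by
    intro W
    induction W with
    | nil => rfl
    | cons w W ih => simp only [List.map_cons, ih]; rfl
  simp only [hubValue, forestValue, h1, h2, Multiset.map_coe, Multiset.sum_coe]

end CodedPath

theorem beqCodes_iff {C : List ℕ} {W : List (List Bool)} :
    beqCodes C (W.map CodedPath.ofWord) = true ↔ C = W.map code := by
  induction C generalizing W with
  | nil => cases W <;> simp [beqCodes]
  | cons c C ih =>
    cases W with
    | nil => simp [beqCodes]
    | cons w W =>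
      simp only [beqCodes, List.map_cons, Bool.and_eq_true, ih, List.cons.injEq]
      exact and_congr_left fun _ => ⟨Nat.eq_of_beq_eq_true, fun h => h ▸ Nat.beq_refl _⟩

/-! ### Soundness of the table check. -/

namespace Table

open CodedPath

/-- The table contains the value `v` for the key `k`. -/
def Mem (k v : ℕ) : Table → Prop
  | .leaf => False
  | .node l key val r => (k = key ∧ v = val) ∨ l.Mem k v ∨ r.Mem k v

theorem mem_of_find {k v : ℕ} {T : Table} (h : T.find k = some v) : T.Mem k v := by
  induction T with
  | leaf => cases h
  | node l key val r ihl ihr =>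
    simp only [find, rec_eq_cond] at h ihl ihr
    cases h1 : Nat.beq k key
    · rw [h1] at h
      cases h2 : Nat.ble k key
      · rw [h2] at h
        exact .inr (.inr (ihr h))
      · rw [h2] at h
        exact .inr (.inl (ihl h))
    · rw [h1] at h
      exact .inl ⟨Nat.eq_of_beq_eq_true h1, by simpa using h.symm⟩

/-- The entries of the table for positions of size less than `n` are correct. -/
def CorrectBelow (T : Table) (n : ℕ) : Prop :=
  ∀ k v, T.Mem k v → ∀ W : List (List Bool), unpack 12 k = W.map code →
    size (true, (W : Multiset (List Bool))) < n → value true W = v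

/-- Packing need not be injective: the lookup also compares the unpacked key with the actual codes,
so a collision could only make the test fail. -/
theorem holds_spec {T : Table} {n : ℕ} (hT : T.CorrectBelow n) {p : ℕ → Bool}
    {s : List CodedPath × ℕ} {N : Multiset (List Bool)} (hs : Reduces s N)
    (hN : size (true, N) < n) (h : T.holds p s = true) : p (value true N) = true := by
  obtain ⟨W, h1, h2, h3⟩ := hs
  rw [holds] at h
  cases h4 : T.find (pack s.1) with
  | none => rw [h4] at h; cases h
  | some v =>
    rw [h4] at h
    simp only [rec_eq_cond, Bool.cond_false_right, Bool.and_eq_true] at h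
    obtain ⟨h5, h6⟩ := h
    rw [h1, beqCodes_iff, ← h1] at h6
    rwa [← h2, hT _ _ (mem_of_find h4) W h6 (by omega)]

theorem hasOption_spec {T : Table} {n : ℕ} (hT : T.CorrectBelow n) {e v₀ v₁ : Bool}
    {W : List (List Bool)} {y : ℕ} (hW : size (true, (W : Multiset (List Bool))) ≤ n)
    (h : T.hasOption e v₀ v₁ (W.map ofWord) y = true) :
    ∃ q, Move (true, (W : Multiset (List Bool))) q ∧ value q.1 q.2 = y := by
  have key : ∀ {e v₀ v₁ : Bool}, anyMove e v₀ v₁ (T.holds (Nat.beq y)) (W.map ofWord) [] = true →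
      ∃ q, Move (true, (W : Multiset (List Bool))) q ∧ value q.1 q.2 = y := by
    intro e v₀ v₁ h
    obtain ⟨N, s, h1, h2, h3⟩ := exists_of_anyMove (V := []) h
    simp only [Multiset.coe_nil, add_zero] at h1
    exact ⟨_, h1, (Nat.eq_of_beq_eq_true
      (holds_spec hT h2 ((Move.size_lt _ _ h1).trans_le hW) h3)).symm⟩
  simp only [hasOption, rec_eq_cond, Bool.cond_true_left, Bool.or_eq_true] at h
  rcases h with h | h | h
  · exact ⟨_, .hub _, by rw [← hubValue_ofWord]; exact Nat.eq_of_beq_eq_true h⟩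
  · exact key h
  · exact key h

/-- There are two ways to refute the value `v`: a different stored value, or an option of the normal
form that already has the value which `v` would require, namely `v` with the split-off nim-sum
removed. -/
theorem maybe_spec {T : Table} {n : ℕ} (hT : T.CorrectBelow n) {e v₀ v₁ : Bool} {v : ℕ}
    {s : List CodedPath × ℕ} {N : Multiset (List Bool)} (hs : Reduces s N)
    (hN : size (true, N) < n) (h : T.maybe e v₀ v₁ v s = false) : value true N ≠ v := by
  simp only [maybe, rec_eq_cond, Bool.cond_false_left, Bool.and_eq_false_imp] at h
  intro hv
  cases h1 : T.holds (fun y => !Nat.beq y v) s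
  · obtain ⟨W, h2, h3, h4⟩ := hs
    have h5 : T.hasOption e v₀ v₁ s.1 (Nat.xor v s.2) = true := by simpa using h (by simp [h1])
    rw [h2] at h5
    obtain ⟨q, hq, hq'⟩ := hasOption_spec hT (by omega) h5
    refine (isGrundy_value _).1 q hq (hq'.trans ?_)
    change v ^^^ s.2 = value true W
    rw [← hv, ← h3, Nat.xor_assoc, Nat.xor_self, Nat.xor_zero]
  · have := holds_spec hT hs hN h1
    rw [hv, Nat.beq_refl] at this
    cases this

theorem check_spec {T : Table} {W : List (List Bool)} {v : ℕ}
    (hT : T.CorrectBelow (size (true, (W : Multiset (List Bool)))))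
    (h : T.check (W.map ofWord) v = true) : value true W = v := by
  simp only [check, rec_eq_cond, Bool.cond_false_left, Bool.and_eq_true, Bool.not_eq_true'] at h
  obtain ⟨h1, h2, h3, h4, h5⟩ := h
  rcases lt_trichotomy (value true W) v with h | h | h
  · have := List.all_eq_true.1 h5 _ (List.mem_range.2 h)
    obtain ⟨q, hq, hq'⟩ := hasOption_spec hT le_rfl this
    exact absurd hq' ((isGrundy_value _).1 q hq)
  · exact h
  · obtain ⟨q, hq, hq'⟩ := (isGrundy_value (true, (W : Multiset (List Bool)))).2 v h
    generalize hM : ((W : Multiset (List Bool))) = M at hq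
    rcases hq with ⟨M⟩ | @⟨_, w, P, N, hP⟩
    · subst hM
      rw [hubValue_ofWord] at h1
      rw [← hq'] at h1
      simp at h1
    · obtain ⟨s, h6, h7⟩ := eq_false_of_anyMove (V := []) h2 h3 h4 hP hM.symm
      simp only [Multiset.coe_nil, add_zero] at h6
      have h8 := Move.size_lt _ _ (Move.word N hP)
      rw [← hM] at h8
      simp only [Bool.and_eq_false_iff] at h7
      rcases h7 with h7 | h7 | h7 <;> exact absurd hq' (maybe_spec hT h6 h8 h7)

/-- Assembles the verification of the whole tree from separate kernel evaluations of its subtrees.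
-/
theorem checkAll_node {T l r : Table} {key val : ℕ}
    (h : (beqCodes (unpack 12 key) (paths key) && T.check (paths key) val) = true)
    (hl : T.checkAll l = true) (hr : T.checkAll r = true) :
    T.checkAll (.node l key val r) = true := by
  simp only [Bool.and_eq_true] at h
  simp [checkAll, h, hl, hr]

theorem mem_check {T S : Table} (h : T.checkAll S = true) {k v : ℕ} (hm : S.Mem k v) :
    beqCodes (unpack 12 k) (paths k) = true ∧ T.check (paths k) v = true := by
  induction S with
  | leaf => cases hm
  | node l key val r ihl ihr =>
    simp only [checkAll, rec_eq_cond, Bool.cond_false_right, Bool.and_eq_true] at h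
    rcases hm with ⟨rfl, rfl⟩ | hm | hm
    · exact h.1
    · exact ihl h.2.1 hm
    · exact ihr h.2.2 hm

/-- Checking the table against itself is not circular: an entry is verified through positions that
arise from it by one or two moves, and normal forms do not increase the size. Induction on the size
therefore applies. -/
theorem correct_of_checkAll {T : Table} (h : T.checkAll T = true) (n : ℕ) : T.CorrectBelow n := by
  induction n with
  | zero => intro k v _ W _ hW; omega
  | succ n ih =>
    intro k v hm W hk hW
    obtain ⟨h1, h2⟩ := mem_check h hm
    have h3 : paths k = ((unpack 12 k).map (decode 25)).map ofWord := by simp [paths]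
    rw [h3, beqCodes_iff] at h1
    have h4 : W = (unpack 12 k).map (decode 25) := by
      apply code_injective.list_map
      rw [← hk, ← h1]
    rw [h3, ← h4] at h2
    exact check_spec (fun k v hm W' hk' hW' => ih k v hm W' hk' (by omega)) h2

/-! The subtrees of the search tree, in increasing order of the keys. -/

def table1 : Table :=
  (.node (.node (.node (.node (.node .leaf 0 1 .leaf) 3 2 .leaf) 5 1 (.node .leaf 7 0 .leaf)) 9 2
  (.node (.node .leaf 17 1 .leaf) 18 1 (.node .leaf 19 3 .leaf))) 21 3 (.node (.node (.node .leaf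
  22 3 .leaf) 23 0 (.node .leaf 25 0 .leaf)) 27 1 (.node (.node .leaf 31 3 .leaf) 35 0 (.node
  .leaf 37 0 .leaf))))

def table2 : Table :=
  (.node (.node (.node (.node (.node .leaf 43 2 .leaf) 45 2 .leaf) 51 2 (.node .leaf 75 1 .leaf))
  77 1 (.node (.node .leaf 78 0 .leaf) 85 1 (.node .leaf 86 1 .leaf))) 94 3 (.node (.node (.node
  .leaf 95 0 .leaf) 99 1 (.node .leaf 101 1 .leaf)) 103 3 (.node (.node .leaf 111 0 .leaf) 119 1
  (.node .leaf 151 0 .leaf))))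

def table3 : Table :=
  (.node (.node (.node (.node (.node .leaf 179 0 .leaf) 199 0 .leaf) 203 0 (.node .leaf 205 0
  .leaf)) 211 0 (.node (.node .leaf 315 1 .leaf) 350 0 (.node .leaf 359 1 .leaf))) 365 1 (.node
  (.node (.node .leaf 366 1 .leaf) 371 1 (.node .leaf 383 0 .leaf)) 407 1 (.node (.node .leaf 411
  1 .leaf) 413 0 (.node .leaf 429 1 .leaf))))

def table4 : Table :=
  (.node (.node (.node (.node .leaf 463 3 .leaf) 495 1 (.node .leaf 1271 1 .leaf)) 1406 1 (.node
  (.node .leaf 1469 1 .leaf) 1502 1 (.node .leaf 1511 1 .leaf))) 1517 1 (.node (.node (.node .leaf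
  1529 1 .leaf) 1535 0 (.node .leaf 1655 1 .leaf)) 1661 1 (.node (.node .leaf 1757 1 .leaf) 1779 1
  (.node .leaf 2015 1 .leaf))))

def table5 : Table :=
  (.node (.node (.node (.node (.node .leaf 6078 1 .leaf) 6123 1 .leaf) 6143 0 (.node .leaf 8127 1
  .leaf)) 32639 1 (.node (.node .leaf 130815 1 .leaf) 523775 1 (.node .leaf 2096127 1 .leaf)))
  8386559 1 (.node (.node (.node .leaf 33550335 1 .leaf) 167772163 2 (.node .leaf 234881029 3
  .leaf)) 301989891 1 (.node (.node .leaf 301989895 0 .leaf) 369098755 3 (.node .leaf 369098757 0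
  .leaf))))

def table6 : Table :=
  (.node (.node (.node (.node .leaf 570425349 1 .leaf) 603979781 1 (.node .leaf 637534211 0
  .leaf)) 637534215 1 (.node (.node .leaf 637534217 0 .leaf) 704643075 0 (.node .leaf 704643081 0
  .leaf))) 704643091 1 (.node (.node (.node .leaf 738197507 0 .leaf) 738197523 1 (.node .leaf
  771751939 2 .leaf)) 771751943 3 (.node (.node .leaf 771751947 0 .leaf) 838860807 1 (.node .leaf
  838860809 0 .leaf))))

def table7 : Table :=
  (.node (.node (.node (.node (.node .leaf 905969675 0 .leaf) 1040187399 1 .leaf) 1040187411 1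
  (.node .leaf 1107296259 1 .leaf)) 1241513989 0 (.node (.node .leaf 1275068421 0 .leaf)
  1308622851 1 (.node .leaf 1308622855 0 .leaf))) 1308622879 0 (.node (.node (.node .leaf
  1375731717 0 .leaf) 1442840579 1 (.node .leaf 1442840585 1 .leaf)) 1442840607 0 (.node (.node
  .leaf 1509949443 1 .leaf) 1509949449 1 (.node .leaf 1577058307 3 .leaf))))

def table8 : Table :=
  (.node (.node (.node (.node .leaf 1577058327 0 .leaf) 1577058331 0 (.node .leaf 1711276035 1
  .leaf)) 1711276039 0 (.node (.node .leaf 1711276063 0 .leaf) 1845493771 1 (.node .leaf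
  2382364677 1 .leaf))) 2650800131 0 (.node (.node (.node .leaf 3053453315 0 .leaf) 3154116611 0
  (.node .leaf 3154116627 1 .leaf)) 3154116630 1 (.node (.node .leaf 3187671043 2 .leaf)
  3187671087 0 (.node .leaf 3388997637 1 .leaf))))

def table9 : Table :=
  (.node (.node (.node (.node (.node .leaf 3657433091 0 .leaf) 3724541955 2 .leaf) 3724541963 0
  (.node .leaf 3858759683 0 .leaf)) 3992977463 0 (.node (.node .leaf 4764729347 1 .leaf)
  5033164803 1 (.node .leaf 5133828099 1 .leaf))) 5167382531 1 (.node (.node (.node .leaf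
  5200936971 1 .leaf) 5335154691 1 (.node .leaf 5670699011 1 .leaf)) 6140461059 1 (.node (.node
  .leaf 6140461065 1 .leaf) 6274678787 1 (.node .leaf 6274678815 0 .leaf))))

def table10 : Table :=
  (.node (.node (.node (.node (.node .leaf 6408896517 0 .leaf) 6408896539 0 .leaf) 6811549699 3
  (.node .leaf 6811549707 1 .leaf)) 6945767427 1 (.node (.node .leaf 7348420611 1 .leaf)
  7482638341 0 (.node .leaf 7751073795 1 .leaf))) 10703863811 0 (.node (.node (.node .leaf
  11777605635 0 .leaf) 12314476547 0 (.node .leaf 12717129731 0 .leaf)) 12817793027 0 (.node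
  (.node .leaf 12851347459 2 .leaf) 14730395651 0 (.node .leaf 15535702019 0 .leaf))))

def table11 : Table :=
  (.node (.node (.node (.node (.node .leaf 24662507523 1 .leaf) 25467813891 1 .leaf) 25669140483 1
  (.node .leaf 25736249349 0 .leaf)) 27883732995 1 (.node (.node .leaf 29494345731 1 .leaf)
  29896998915 1 (.node .leaf 32178700315 0 .leaf))) 32715571203 1 (.node (.node (.node .leaf
  33252442117 0 .leaf) 42916118531 0 (.node .leaf 46103789571 1 .leaf)) 47211085827 0 (.node
  (.node .leaf 51371835395 0 .leaf) 51472498691 0 (.node .leaf 54727278597 1 .leaf))))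

def table12 : Table :=
  (.node (.node (.node (.node .leaf 85865791491 1 .leaf) 98750693379 1 (.node .leaf 101971918851 1
  .leaf)) 102777225219 1 (.node (.node .leaf 102978551811 1 .leaf) 103045660677 0 (.node .leaf
  111635595267 1 .leaf))) 118078046211 1 (.node (.node (.node .leaf 119688658947 1 .leaf)
  120091312131 1 (.node .leaf 206091321347 0 .leaf)) 395103436803 1 (.node (.node .leaf
  407988338691 1 .leaf) 412014870531 1 (.node .leaf 412216197123 1 .leaf))))

def table13 : Table :=
  (.node (.node (.node (.node (.node .leaf 472412848131 1 .leaf) 478855299075 1 .leaf)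
  480465911811 1 (.node .leaf 480868564995 1 .leaf)) 10133099329355779 1 (.node (.node .leaf
  12384899143041027 3 .leaf) 12384899277258755 0 (.node .leaf 12384899277258759 1 .leaf)))
  19140298651205635 0 (.node (.node (.node .leaf 20266198625157123 1 .leaf) 21392098397782019 0
  (.node .leaf 21392098599108611 1 .leaf)) 23643898211467267 0 (.node (.node .leaf
  28147497905946627 2 .leaf) 28147497905946629 1 (.node .leaf 30399297719631875 0 .leaf))))

def table14 : Table :=
  (.node (.node (.node (.node .leaf 30399298122285059 0 .leaf) 30399298189393923 0 (.node .leaf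
  30399298323611651 0 .leaf)) 34902897279893507 0 (.node (.node .leaf 34902897347002373 1 .leaf)
  34902897414111237 0 (.node .leaf 34902897481220099 1 .leaf))) 34902897481220105 1 (.node (.node
  (.node .leaf 34902897883873287 1 .leaf) 34902897950982149 1 (.node .leaf 34902898018091011 0
  .leaf)) 37154697093578755 1 (.node (.node .leaf 38280597000421379 1 .leaf) 42784196694900739 1
  (.node .leaf 43910096534634499 1 .leaf))))

def table15 : Table :=
  (.node (.node (.node (.node (.node .leaf 50665495975690243 1 .leaf) 52917295923593219 0 .leaf)
  52917295990702085 0 (.node .leaf 52917296326246403 0 .leaf)) 57420895618072583 1 (.node (.node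
  .leaf 83316593475452931 1 .leaf) 88946092808339459 0 (.node .leaf 88946092875448325 1 .leaf)))
  97953292063080451 0 (.node (.node (.node .leaf 97953292264407043 1 .leaf) 102456891690450947 0
  (.node .leaf 106960491787583491 0 .leaf)) 115967690572562435 0 (.node (.node .leaf
  120471290401259523 1 .leaf) 142989288336785411 0 (.node .leaf 183521684983119875 1 .leaf))))

def table16 : Table :=
  (.node (.node (.node (.node .leaf 208291483000766467 0 .leaf) 210543282747342851 1 (.node .leaf
  210543286304112643 1 .leaf)) 215046882508931075 0 (.node (.node .leaf 260082879252398083 1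
  .leaf) 575334852564353027 0 (.node .leaf 863565228850282499 0 .leaf))) 863565229185826819 1
  (.node (.node (.node .leaf 4394387336574533635 1 .leaf) 415568258373828294475779 1 (.node .leaf
  415568260625628108161027 0 .leaf)) 642241849551571264733187 0 (.node (.node .leaf
  642241854055170959212547 1 .leaf) 944473308958828185780227 1 (.node .leaf
  4797924358980458680156163 1 .leaf))))

/-- Positions reached by the winning strategy of the second player, with their values. -/
def table : Table :=
  (.node (.node (.node (.node table1 38 0 table2) 158 0 (.node table3 447 0 table4)) 5087 1 (.node
  (.node table5 369098759 2 table6) 905969669 1 (.node table7 1577058309 1 table8))) 3590324227 0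
  (.node (.node (.node table9 6341787651 1 table10) 21441282051 1 (.node table11 62243471363 0
  table12)) 446643044355 1 (.node (.node table13 30399297786740739 1 table14) 48413696900202499 1
  (.node table15 190277084424175619 1 table16))))

theorem checkAll_table1 : table.checkAll table1 = true := by decide +kernel

theorem checkAll_table2 : table.checkAll table2 = true := by decide +kernel

theorem checkAll_table3 : table.checkAll table3 = true := by decide +kernel

theorem checkAll_table4 : table.checkAll table4 = true := by decide +kernel

theorem checkAll_table5 : table.checkAll table5 = true := by decide +kernel

theorem checkAll_table6 : table.checkAll table6 = true := by decide +kernel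

theorem checkAll_table7 : table.checkAll table7 = true := by decide +kernel

theorem checkAll_table8 : table.checkAll table8 = true := by decide +kernel

theorem checkAll_table9 : table.checkAll table9 = true := by decide +kernel

theorem checkAll_table10 : table.checkAll table10 = true := by decide +kernel

theorem checkAll_table11 : table.checkAll table11 = true := by decide +kernel

theorem checkAll_table12 : table.checkAll table12 = true := by decide +kernel

theorem checkAll_table13 : table.checkAll table13 = true := by decide +kernel

theorem checkAll_table14 : table.checkAll table14 = true := by decide +kernel

theorem checkAll_table15 : table.checkAll table15 = true := by decide +kernel

theorem checkAll_table16 : table.checkAll table16 = true := by decide +kernel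

theorem checkAll_table : table.checkAll table = true :=
  checkAll_node (by decide +kernel) (checkAll_node (by decide +kernel) (checkAll_node
    (by decide +kernel) (checkAll_node (by decide +kernel) checkAll_table1 checkAll_table2)
    (checkAll_node (by decide +kernel) checkAll_table3 checkAll_table4)) (checkAll_node
    (by decide +kernel) (checkAll_node (by decide +kernel) checkAll_table5 checkAll_table6)
    (checkAll_node (by decide +kernel) checkAll_table7 checkAll_table8))) (checkAll_node
    (by decide +kernel) (checkAll_node (by decide +kernel) (checkAll_node (by decide +kernel)
    checkAll_table9 checkAll_table10) (checkAll_node (by decide +kernel) checkAll_table11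
    checkAll_table12)) (checkAll_node (by decide +kernel) (checkAll_node (by decide +kernel)
    checkAll_table13 checkAll_table14) (checkAll_node (by decide +kernel) checkAll_table15
    checkAll_table16)))

/-- A path of even length in which all spokes but one of the two middle ones are present. -/
theorem value_replicate_false_replicate {a : ℕ} (ha : a < 12) :
    value true {List.replicate a true ++ false :: List.replicate (a + 1) true} = 1 := by
  -- Twelve lookups, for paths with up to 24 vertices. The two empty lists only give the expression
  -- the shape of `reduces_addAll`.
  have h : ∀ a < 12, table.holds (Nat.beq 1) (CodedPath.addAll ([].map CodedPath.ofWord)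
      (CodedPath.addAll ([].map CodedPath.ofWord) (CodedPath.addAll
        ([List.replicate a true ++ false :: List.replicate (a + 1) true].map CodedPath.ofWord)
        ([], 0)))) = true := by
    decide +kernel
  have := holds_spec (correct_of_checkAll checkAll_table _) (CodedPath.reduces_addAll _ _ _)
    (Nat.lt_succ_self _) (h a ha)
  simpa using (Nat.eq_of_beq_eq_true this).symm

end Table

open scoped Graph

/-! ### Graphs that consist of a hub and paths -/

/-- The edges of the path through the vertices in a list. -/
def pathEdges {α : Type*} : List α → List (Sym2 α)
  | [] => []
  | [_] => []
  | x :: y :: l => s(x, y) :: pathEdges (y :: l)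

theorem pathEdges_append {α : Type*} (p : List α) (x y : α) (q : List α) :
    pathEdges (p ++ x :: y :: q) = pathEdges (p ++ [x]) ++ s(x, y) :: pathEdges (y :: q) := by
  induction p with
  | nil => simp [pathEdges]
  | cons a p ih =>
    cases p with
    | nil => simp [pathEdges]
    | cons b p => simp only [List.cons_append, pathEdges] at ih ⊢; rw [ih]

theorem mem_of_mem_pathEdges {α : Type*} {l : List α} {e : Sym2 α} (he : e ∈ pathEdges l) {z : α}
    (hz : z ∈ e) : z ∈ l := by
  induction l with
  | nil => simp [pathEdges] at he
  | cons a l ih =>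
    cases l with
    | nil => simp [pathEdges] at he
    | cons b l =>
      simp only [pathEdges, List.mem_cons] at he
      rcases he with rfl | he
      · rcases Sym2.mem_iff.1 hz with rfl | rfl <;> simp
      · exact List.mem_cons_of_mem _ (ih he)

theorem exists_of_mem_pathEdges {α : Type*} {l : List α} {e : Sym2 α} (he : e ∈ pathEdges l) :
    ∃ p x y q, l = p ++ x :: y :: q ∧ e = s(x, y) := by
  induction l with
  | nil => simp [pathEdges] at he
  | cons a l ih =>
    cases l with
    | nil => simp [pathEdges] at he
    | cons b l =>
      simp only [pathEdges, List.mem_cons] at he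
      rcases he with rfl | he
      · exact ⟨[], a, b, l, rfl, rfl⟩
      · obtain ⟨p, x, y, q, h, rfl⟩ := ih he
        exact ⟨a :: p, x, y, q, by rw [h]; rfl, rfl⟩

/-- Only the edges to the neighbours of `v` contain it, so deleting `v` splits the path into `p` and
`q`. -/
theorem mem_pathEdges_and_notMem_iff {α : Type*} {p q : List α} {v : α} {e : Sym2 α}
    (hp : v ∉ p) (hq : v ∉ q) :
    (e ∈ pathEdges (p ++ v :: q) ∧ v ∉ e) ↔ e ∈ pathEdges p ∨ e ∈ pathEdges q := by
  induction p with
  | nil =>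
    cases q with
    | nil => simp [pathEdges]
    | cons b q =>
      simp only [List.nil_append, pathEdges, List.mem_cons, List.not_mem_nil, false_or]
      constructor
      · rintro ⟨rfl | h, hv⟩
        · simp at hv
        · exact h
      · exact fun h => ⟨.inr h, fun hv => hq (mem_of_mem_pathEdges h hv)⟩
  | cons a p ih =>
    simp only [List.mem_cons, not_or] at hp
    have ih := ih hp.2
    cases p with
    | nil =>
      simp only [List.nil_append, List.cons_append, pathEdges, List.mem_cons, List.not_mem_nil,
        false_or] at ih ⊢
      rw [← ih]
      constructor
      · rintro ⟨rfl | h, hv⟩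
        · simp at hv
        · exact ⟨h, hv⟩
      · exact fun h => ⟨.inr h.1, h.2⟩
    | cons b p =>
      simp only [List.cons_append, pathEdges, List.mem_cons, or_assoc] at ih ⊢
      rw [← ih]
      constructor
      · rintro ⟨rfl | h, hv⟩
        · exact .inl rfl
        · exact .inr ⟨h, hv⟩
      · rintro (rfl | ⟨h, hv⟩)
        · refine ⟨.inl rfl, ?_⟩
          simp only [List.mem_cons, not_or] at hp
          simp [hp.1, hp.2.1]
        · exact ⟨.inr h, hv⟩

/-- Every edge is labelled by the pair of its ends. -/
def Labelled {α : Type*} (G : Graph α (Sym2 α)) : Prop :=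
  ∀ e x y, G.IsLink e x y ↔ e = s(x, y) ∧ e ∈ E(G)

theorem Labelled.deleteEdges {α : Type*} {G : Graph α (Sym2 α)} (hG : Labelled G)
    (F : Set (Sym2 α)) : Labelled (G.deleteEdges F) := by
  intro e x y
  simp only [Graph.deleteEdges_isLink, hG e x y, Graph.edgeSet_deleteEdges, Set.mem_sdiff,
    and_assoc]

theorem Labelled.mem_edgeSet_deleteVerts {α : Type*} {G : Graph α (Sym2 α)} (hG : Labelled G)
    {v : α} {e : Sym2 α} : e ∈ E(G.deleteVerts {v}) ↔ e ∈ E(G) ∧ v ∉ e := by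
  simp only [Graph.edgeSet_deleteVerts, Set.mem_ofPred_eq, Set.mem_singleton_iff]
  constructor
  · rintro ⟨x, y, h, hx, hy⟩
    obtain ⟨rfl, he⟩ := (hG _ _ _).1 h
    exact ⟨he, by simp [Ne.symm hx, Ne.symm hy]⟩
  · induction e with
    | h x y =>
      rintro ⟨he, hv⟩
      simp only [Sym2.mem_iff, not_or] at hv
      exact ⟨x, y, (hG _ _ _).2 ⟨rfl, he⟩, Ne.symm hv.1, Ne.symm hv.2⟩

theorem Labelled.deleteVerts {α : Type*} {G : Graph α (Sym2 α)} (hG : Labelled G)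
    (v : α) : Labelled (G.deleteVerts {v}) := by
  intro e x y
  rw [Graph.deleteVerts_isLink, hG e x y, hG.mem_edgeSet_deleteVerts]
  constructor
  · rintro ⟨⟨rfl, he⟩, hx, hy⟩
    simp only [Set.mem_singleton_iff] at hx hy
    exact ⟨rfl, he, by simp [Ne.symm hx, Ne.symm hy]⟩
  · rintro ⟨rfl, he, hv⟩
    simp only [Sym2.mem_iff, not_or] at hv
    exact ⟨⟨rfl, he⟩, Ne.symm hv.1, Ne.symm hv.2⟩

/-- `G` consists of the hub `h` (if `b` holds), the paths in `L`, and spokes from the hub to the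
vertices selected by `sp`. -/
structure IsHubGraph {α : Type*} (h : α) (sp : α → Bool) (b : Bool) (L : List (List α))
    (G : Graph α (Sym2 α)) : Prop where
  nodup : L.flatten.Nodup
  hub_notMem : h ∉ L.flatten
  labelled : Labelled G
  mem_vertexSet : ∀ x, x ∈ V(G) ↔ (b = true ∧ x = h) ∨ x ∈ L.flatten
  mem_edgeSet : ∀ e, e ∈ E(G) ↔ (∃ l ∈ L, e ∈ pathEdges l) ∨
    (b = true ∧ ∃ x ∈ L.flatten, sp x = true ∧ e = s(h, x))

namespace IsHubGraph

variable {α : Type*} {h : α} {sp : α → Bool} {b : Bool} {L : List (List α)}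
  {G : Graph α (Sym2 α)}

theorem perm {L' : List (List α)} (hG : IsHubGraph h sp b L G) (hL : L.Perm L') :
    IsHubGraph h sp b L' G where
  nodup := (hL.flatten.nodup_iff).1 hG.nodup
  hub_notMem := by rw [← hL.flatten.mem_iff]; exact hG.hub_notMem
  labelled := hG.labelled
  mem_vertexSet x := by rw [hG.mem_vertexSet, hL.flatten.mem_iff]
  mem_edgeSet e := by simp only [hG.mem_edgeSet, hL.flatten.mem_iff, hL.mem_iff]

theorem deleteHub (hG : IsHubGraph h sp true L G) :
    IsHubGraph h sp false L (G.deleteVerts {h}) where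
  nodup := hG.nodup
  hub_notMem := hG.hub_notMem
  labelled := hG.labelled.deleteVerts h
  mem_vertexSet x := by
    simp only [Graph.vertexSet_deleteVerts, Set.mem_sdiff, hG.mem_vertexSet,
      Set.mem_singleton_iff, Bool.false_eq_true, false_and, false_or, true_and]
    constructor
    · rintro ⟨h1 | h1, h2⟩
      · exact absurd h1 h2
      · exact h1
    · exact fun h1 => ⟨.inr h1, fun h2 => hG.hub_notMem (h2 ▸ h1)⟩
  mem_edgeSet e := by
    simp only [hG.labelled.mem_edgeSet_deleteVerts, hG.mem_edgeSet, Bool.false_eq_true, false_and,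
      or_false, true_and]
    constructor
    · rintro ⟨h1 | ⟨x, -, -, rfl⟩, h2⟩
      · exact h1
      · simp at h2
    · rintro ⟨l, hl, he⟩
      exact ⟨.inl ⟨l, hl, he⟩, fun h2 =>
        hG.hub_notMem (List.mem_flatten.2 ⟨l, hl, mem_of_mem_pathEdges he h2⟩)⟩

theorem deleteVert {p q : List α} {v : α} (hG : IsHubGraph h sp b ((p ++ v :: q) :: L) G) :
    IsHubGraph h sp b (p :: q :: L) (G.deleteVerts {v}) := by
  have hn := hG.nodup
  have hh := hG.hub_notMem
  simp only [List.flatten_cons, List.append_assoc, List.cons_append, List.mem_append,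
    List.mem_cons, not_or] at hn hh
  rw [List.nodup_middle, List.nodup_cons] at hn
  obtain ⟨hv, hn⟩ := hn
  simp only [List.mem_append, not_or] at hv
  have hvL : ∀ l ∈ L, v ∉ l := fun l hl hvl => hv.2.2 (List.mem_flatten.2 ⟨l, hl, hvl⟩)
  refine ⟨by simpa using hn, ?_, hG.labelled.deleteVerts v, fun x => ?_, fun e => ?_⟩
  · simp only [List.flatten_cons, List.mem_append, not_or]
    tauto
  · simp only [Graph.vertexSet_deleteVerts, Set.mem_sdiff, hG.mem_vertexSet,
      Set.mem_singleton_iff, List.flatten_cons, List.mem_append, List.mem_cons]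
    by_cases hxv : x = v
    · subst hxv
      have : x ≠ h := Ne.symm hh.2.1
      tauto
    · tauto
  · rw [hG.labelled.mem_edgeSet_deleteVerts, hG.mem_edgeSet, or_and_right]
    apply or_congr
    · have := mem_pathEdges_and_notMem_iff (e := e) hv.1 hv.2.1
      have h2 : (∃ l ∈ L, e ∈ pathEdges l) → v ∉ e := fun ⟨l, hl, he⟩ hve =>
        hvL l hl (mem_of_mem_pathEdges he hve)
      simp only [List.mem_cons, exists_eq_or_imp]
      rw [or_and_right, this, or_assoc, and_iff_left_of_imp h2]
    · constructor
      · rintro ⟨⟨rfl, x, hx, hs, rfl⟩, hve⟩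
        simp only [Sym2.mem_iff, not_or] at hve
        refine ⟨rfl, x, ?_, hs, rfl⟩
        have := Ne.symm hve.2
        simp only [List.flatten_cons, List.mem_append, List.mem_cons] at hx ⊢
        tauto
      · rintro ⟨rfl, x, hx, hs, rfl⟩
        simp only [List.flatten_cons, List.mem_append] at hx
        have hxv : x ≠ v := by
          rintro rfl
          tauto
        have hvh : v ≠ h := Ne.symm hh.2.1
        refine ⟨⟨rfl, x, ?_, hs, rfl⟩, by simp [hxv.symm, hvh]⟩
        simp only [List.flatten_cons, List.mem_append, List.mem_cons]
        tauto

theorem deleteEdge {p q : List α} {x y : α}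
    (hG : IsHubGraph h sp b ((p ++ x :: y :: q) :: L) G) :
    IsHubGraph h sp b ((p ++ [x]) :: (y :: q) :: L) (G.deleteEdges {s(x, y)}) := by
  have hfl : (((p ++ [x]) :: (y :: q) :: L)).flatten = ((p ++ x :: y :: q) :: L).flatten := by
    simp
  have hn := hG.nodup
  have hh := hG.hub_notMem
  rw [← hfl] at hn hh
  refine ⟨hn, hh, hG.labelled.deleteEdges _, fun z => ?_, fun e => ?_⟩
  · rw [hfl, Graph.vertexSet_deleteEdges, hG.mem_vertexSet]
  · rw [Graph.edgeSet_deleteEdges, Set.mem_sdiff, hG.mem_edgeSet, hfl, Set.mem_singleton_iff,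
      or_and_right]
    simp only [List.flatten_cons, List.nodup_append, List.mem_append, List.mem_cons] at hn
    apply or_congr
    · simp only [List.mem_cons, exists_eq_or_imp, pathEdges_append, List.mem_append]
      -- No vertex is repeated, so the pair `s(x, y)` occurs at this one place only and removing the
      -- label removes exactly one path edge.
      have h1 : e ∈ pathEdges (p ++ [x]) → e ≠ s(x, y) := by
        rintro he rfl
        have := mem_of_mem_pathEdges he (Sym2.mem_mk_right x y)
        exact hn.2.2 y (by simpa using this) y (.inl (.inl rfl)) rfl
      have h2 : e ∈ pathEdges (y :: q) → e ≠ s(x, y) := by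
        rintro he rfl
        have := mem_of_mem_pathEdges he (Sym2.mem_mk_left x y)
        exact hn.2.2 x (by simp) x (.inl (by simpa using this)) rfl
      have h3 : (∃ l ∈ L, e ∈ pathEdges l) → e ≠ s(x, y) := by
        rintro ⟨l, hl, he⟩ rfl
        have := mem_of_mem_pathEdges he (Sym2.mem_mk_left x y)
        exact hn.2.2 x (by simp) x (.inr (List.mem_flatten.2 ⟨l, hl, this⟩)) rfl
      generalize (∃ l ∈ L, e ∈ pathEdges l) = P at *
      generalize (e ∈ pathEdges (p ++ [x])) = Q at *
      generalize (e ∈ pathEdges (y :: q)) = R at *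
      simp only [ne_eq] at h1 h2 h3
      generalize (e = s(x, y)) = S at *
      clear hG hfl hh hn
      tauto
    · constructor
      · exact fun h => h.1
      · refine fun h1 => ⟨h1, ?_⟩
        obtain ⟨-, z, -, -, rfl⟩ := h1
        intro h2
        have h3 : h ∈ s(x, y) := h2 ▸ Sym2.mem_mk_left h z
        simp only [List.flatten_cons, List.mem_append, List.mem_cons, not_or,
          List.not_mem_nil, not_false_eq_true, and_true] at hh
        rcases Sym2.mem_iff.1 h3 with h3 | h3
        · exact hh.1.2 h3
        · exact hh.2.1.1 h3

theorem deleteSpoke [DecidableEq α] (hG : IsHubGraph h sp true L G) {x : α}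
    (hx : x ∈ L.flatten) :
    IsHubGraph h (Function.update sp x false) true L (G.deleteEdges {s(h, x)}) where
  nodup := hG.nodup
  hub_notMem := hG.hub_notMem
  labelled := hG.labelled.deleteEdges _
  mem_vertexSet z := by rw [Graph.vertexSet_deleteEdges, hG.mem_vertexSet]
  mem_edgeSet e := by
    rw [Graph.edgeSet_deleteEdges, Set.mem_sdiff, hG.mem_edgeSet, Set.mem_singleton_iff,
      or_and_right]
    apply or_congr
    · refine ⟨fun h1 => h1.1, fun h1 => ⟨h1, ?_⟩⟩
      rintro rfl
      obtain ⟨l, hl, he⟩ := h1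
      exact hG.hub_notMem (List.mem_flatten.2 ⟨l, hl,
        mem_of_mem_pathEdges he (Sym2.mem_mk_left h x)⟩)
    · constructor
      · rintro ⟨⟨-, z, hz, hs, rfl⟩, hne⟩
        have hzx : z ≠ x := fun hzx => hne (by rw [hzx])
        exact ⟨rfl, z, hz, by rwa [Function.update_of_ne hzx], rfl⟩
      · rintro ⟨-, z, hz, hs, rfl⟩
        have hzx : z ≠ x := by
          rintro rfl
          simp at hs
        rw [Function.update_of_ne hzx] at hs
        refine ⟨⟨rfl, z, hz, hs, rfl⟩, fun h1 => hzx ?_⟩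
        exact Sym2.congr_right.1 h1

/-- The word that describes a list of paths. -/
def words (sp : α → Bool) (L : List (List α)) : Multiset (List Bool) :=
  (L.map (List.map sp) : List (List Bool))

theorem words_update [DecidableEq α] {x : α} (hx : x ∉ L.flatten) :
    words (Function.update sp x false) L = words sp L := by
  unfold words
  congr 1
  refine List.map_congr_left fun l hl => List.map_congr_left fun z hz => ?_
  exact Function.update_of_ne (fun hzx => hx (List.mem_flatten.2 ⟨l, hl, by rwa [← hzx]⟩)) _ _

theorem words_perm {L' : List (List α)} (hL : L.Perm L') : words sp L = words sp L' :=
  Multiset.coe_eq_coe.2 (hL.map _)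

theorem words_cons (l : List α) : words sp (l :: L) = l.map sp ::ₘ words sp L := rfl

theorem words_update_append [DecidableEq α] {p q : List α} {x : α}
    (hn : ((p ++ x :: q) :: L).flatten.Nodup) :
    words (Function.update sp x false) ((p ++ x :: q) :: L) =
      (p.map sp ++ false :: q.map sp) ::ₘ words sp L := by
  simp only [List.flatten_cons, List.append_assoc, List.cons_append] at hn
  rw [List.nodup_middle, List.nodup_cons] at hn
  simp only [List.mem_append, not_or] at hn
  have hp : ∀ l : List α, x ∉ l → l.map (Function.update sp x false) = l.map sp := fun l hl =>
    List.map_congr_left fun z hz => Function.update_of_ne (fun hzx => hl (by rwa [← hzx])) _ _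
  simp [words_cons, words_update hn.1.2.2, hp p hn.1.1, hp q hn.1.2.1]

/-- An empty path can be ignored. -/
theorem of_nil_cons (hG : IsHubGraph h sp b ([] :: L) G) : IsHubGraph h sp b L G where
  nodup := hG.nodup
  hub_notMem := hG.hub_notMem
  labelled := hG.labelled
  mem_vertexSet := hG.mem_vertexSet
  mem_edgeSet e := by simpa [pathEdges] using hG.mem_edgeSet e

/-- The value of a graph that consists of a hub and paths. -/
theorem nimValue_eq [Finite α] (hG : IsHubGraph h sp b L G) :
    nimValue G = value b (words sp L) := by
  classical
  refine isGrundy_nimValue.eq_of_simulation isGrundy_value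
    (fun G => V(G).ncard + E(G).ncard) (fun _ _ h => h.ncard_lt)
    (fun G x => ∃ sp L, IsHubGraph h sp x.1 L G ∧ x.2 = words sp L) ?_ ?_
    (q := (b, words sp L)) ⟨sp, L, hG, rfl⟩
  · rintro G ⟨b, M⟩ ⟨sp, L, hG, hM⟩ q' hq'
    obtain rfl : M = words sp L := hM
    generalize hM : words sp L = M at hq'
    rcases hq' with ⟨M⟩ | @⟨_, w, P, N, hP⟩
    · exact ⟨_, .inl ⟨h, (hG.mem_vertexSet h).2 (.inl ⟨rfl, rfl⟩), rfl⟩, sp, L, hG.deleteHub,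
        hM.symm⟩
    · have hw : w ∈ words sp L := hM ▸ Multiset.mem_cons_self w N
      obtain ⟨l, hl, rfl⟩ := List.mem_map.1 (Multiset.mem_coe.1 hw)
      obtain ⟨L', hL'⟩ : ∃ L', L.Perm (l :: L') := ⟨_, List.perm_cons_erase hl⟩
      have hG := hG.perm hL'
      obtain rfl : N = words sp L' := by
        rw [words_perm hL', words_cons, Multiset.cons_inj_right] at hM
        exact hM.symm
      generalize hw : l.map sp = w at hP
      cases hP with
      | spoke p q hb =>
        dsimp only at hG hb
        subst hb
        obtain ⟨p, l', rfl, rfl, hl'⟩ := List.map_eq_append_iff.1 hw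
        obtain ⟨x, q, rfl, hx, rfl⟩ := List.map_eq_cons_iff.1 hl'
        have hx' : x ∈ ((p ++ x :: q) :: L').flatten := by simp
        refine ⟨_, .inr ⟨s(h, x), (hG.mem_edgeSet _).2 (.inr ⟨rfl, x, hx', hx, rfl⟩), rfl⟩,
          _, _, hG.deleteSpoke hx', ?_⟩
        rw [words_update_append hG.nodup]
        rfl
      | cut p q h1 h2 =>
        obtain ⟨p, q, rfl, rfl, rfl⟩ := List.map_eq_append_iff.1 hw
        obtain ⟨p, x, rfl⟩ := (List.eq_nil_or_concat' _).resolve_left (by simpa using h1 : p ≠ [])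
        obtain ⟨y, q, rfl⟩ := List.exists_cons_of_ne_nil (by simpa using h2 : q ≠ [])
        rw [List.append_assoc, List.singleton_append] at hG
        refine ⟨_, .inr ⟨s(x, y), (hG.mem_edgeSet _).2 (.inl ⟨_, List.mem_cons_self, ?_⟩), rfl⟩,
          _, _, hG.deleteEdge, ?_⟩
        · simp [pathEdges_append]
        · simp [words_cons]
      | vertex p c q =>
        obtain ⟨p, l', rfl, rfl, hl'⟩ := List.map_eq_append_iff.1 hw
        obtain ⟨x, q, rfl, hx, rfl⟩ := List.map_eq_cons_iff.1 hl'
        exact ⟨_, .inl ⟨x, (hG.mem_vertexSet _).2 (.inr (by simp)), rfl⟩, _, _, hG.deleteVert,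
          by simp [words_cons]⟩
  · rintro G ⟨b, M⟩ ⟨sp, L, hG, hM⟩ G' hG'
    obtain rfl : M = words sp L := hM
    -- Moves in the graph and moves on words correspond exactly, so no replies are needed.
    left
    have hsplit : ∀ l ∈ L, ∃ L', L.Perm (l :: L') := fun l hl => ⟨_, List.perm_cons_erase hl⟩
    rcases hG' with ⟨v, hv, rfl⟩ | ⟨e, he, rfl⟩
    · rcases (hG.mem_vertexSet v).1 hv with ⟨hb, rfl⟩ | hv
      · dsimp only at hb hG
        subst hb
        exact ⟨_, .hub _, sp, L, hG.deleteHub, rfl⟩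
      · obtain ⟨l, hl, hv⟩ := List.mem_flatten.1 hv
        obtain ⟨L', hL'⟩ := hsplit l hl
        obtain ⟨p, q, rfl⟩ := List.append_of_mem hv
        refine ⟨(b, words sp (p :: q :: L')), ?_, sp, _, (hG.perm hL').deleteVert, rfl⟩
        have := Move.word (words sp L') (WordMove.vertex (b := b) (p.map sp) (sp v) (q.map sp))
        simpa [words_perm hL', words_cons] using this
    · rcases (hG.mem_edgeSet e).1 he with ⟨l, hl, he⟩ | ⟨hb, x, hx, hs, rfl⟩
      · obtain ⟨L', hL'⟩ := hsplit l hl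
        obtain ⟨p, x, y, q, rfl, rfl⟩ := exists_of_mem_pathEdges he
        refine ⟨(b, words sp ((p ++ [x]) :: (y :: q) :: L')), ?_, sp, _,
          (hG.perm hL').deleteEdge, rfl⟩
        have := Move.word (words sp L') (WordMove.cut (b := b) ((p ++ [x]).map sp)
          ((y :: q).map sp) (by simp) (by simp))
        simpa [words_perm hL', words_cons] using this
      · dsimp only at hb hG
        subst hb
        obtain ⟨l, hl, hxl⟩ := List.mem_flatten.1 hx
        obtain ⟨L', hL'⟩ := hsplit l hl
        obtain ⟨p, q, rfl⟩ := List.append_of_mem hxl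
        have hG' := hG.perm hL'
        refine ⟨(true, words (Function.update sp x false) ((p ++ x :: q) :: L')), ?_, _, _,
          hG'.deleteSpoke ?_, rfl⟩
        · rw [words_perm hL']
          have := Move.word (words sp L') (WordMove.spoke (p.map sp) (q.map sp) rfl)
          rw [words_update_append hG'.nodup]
          simpa [words_cons, hs] using this
        · simp

end IsHubGraph

/-! ### A mirror strategy -/

/-- The involution `φ` acts on `G`; it fixes at most the vertex `h` and no edge. -/
structure IsMirrored {α : Type*} (h : α) (φ : α → α) (G : Graph α (Sym2 α)) : Prop where
  labelled : Labelled G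
  mem_vertexSet : ∀ x ∈ V(G), φ x ∈ V(G)
  mem_edgeSet : ∀ e ∈ E(G), e.map φ ∈ E(G)
  map_ne : ∀ e ∈ E(G), e.map φ ≠ e

namespace IsMirrored

variable {α : Type*} {h : α} {φ : α → α} {G : Graph α (Sym2 α)}

theorem deleteHub (hG : IsMirrored h φ G) (hφ : φ.Involutive) (hh : φ h = h) :
    IsMirrored h φ (G.deleteVerts {h}) where
  labelled := hG.labelled.deleteVerts h
  mem_vertexSet x := by
    simp only [Graph.vertexSet_deleteVerts, Set.mem_sdiff, Set.mem_singleton_iff]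
    exact fun hx => ⟨hG.mem_vertexSet x hx.1, fun hx' => hx.2 (by rw [← hφ x, hx', hh])⟩
  mem_edgeSet e := by
    rw [hG.labelled.mem_edgeSet_deleteVerts, hG.labelled.mem_edgeSet_deleteVerts]
    refine fun he => ⟨hG.mem_edgeSet e he.1, fun he' => he.2 ?_⟩
    obtain ⟨a, ha, hah⟩ := Sym2.mem_map.1 he'
    rwa [← hh, ← hah, hφ]
  map_ne e := by
    rw [hG.labelled.mem_edgeSet_deleteVerts]
    exact fun he => hG.map_ne e he.1

theorem deleteVerts (hG : IsMirrored h φ G) (hφ : φ.Involutive) (v : α) :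
    IsMirrored h φ ((G.deleteVerts {v}).deleteVerts {φ v}) where
  labelled := (hG.labelled.deleteVerts v).deleteVerts (φ v)
  mem_vertexSet x := by
    simp only [Graph.vertexSet_deleteVerts, Set.mem_sdiff, Set.mem_singleton_iff]
    exact fun hx => ⟨⟨hG.mem_vertexSet x hx.1.1, fun hx' => hx.2 (by rw [← hφ x, hx'])⟩,
      fun hx' => hx.1.2 (hφ.injective hx')⟩
  mem_edgeSet e := by
    simp only [(hG.labelled.deleteVerts v).mem_edgeSet_deleteVerts,
      hG.labelled.mem_edgeSet_deleteVerts]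
    refine fun he => ⟨⟨hG.mem_edgeSet e he.1.1, fun he' => he.2 ?_⟩, fun he' => he.1.2 ?_⟩
    · obtain ⟨a, ha, hav⟩ := Sym2.mem_map.1 he'
      rwa [← hav, hφ]
    · obtain ⟨a, ha, hav⟩ := Sym2.mem_map.1 he'
      rwa [← hφ.injective hav]
  map_ne e := by
    simp only [(hG.labelled.deleteVerts v).mem_edgeSet_deleteVerts,
      hG.labelled.mem_edgeSet_deleteVerts]
    exact fun he => hG.map_ne e he.1.1

theorem deleteEdges (hG : IsMirrored h φ G) (hφ : φ.Involutive) (e : Sym2 α) :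
    IsMirrored h φ ((G.deleteEdges {e}).deleteEdges {e.map φ}) where
  labelled := (hG.labelled.deleteEdges {e}).deleteEdges {e.map φ}
  mem_vertexSet x := by simpa using hG.mem_vertexSet x
  mem_edgeSet d := by
    have hmap : ∀ d : Sym2 α, (d.map φ).map φ = d := fun d => by
      rw [Sym2.map_map, hφ.comp_self, Sym2.map_id]; rfl
    simp only [Graph.edgeSet_deleteEdges, Set.mem_sdiff, Set.mem_singleton_iff]
    exact fun hd => ⟨⟨hG.mem_edgeSet d hd.1.1, fun hd' => hd.2 (by rw [← hd', hmap])⟩,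
      fun hd' => hd.1.2 (by rw [← hmap d, hd', hmap])⟩
  map_ne d := by
    simp only [Graph.edgeSet_deleteEdges, Set.mem_sdiff]
    exact fun hd => hG.map_ne d hd.1.1

/-- The second player answers every move by its mirror image. -/
theorem nimValue_eq_one [Finite α] (hG : IsMirrored h φ G) (hφ : φ.Involutive)
    (hfix : ∀ x, φ x = x ↔ x = h) (hh : h ∈ V(G)) : nimValue G = 1 := by
  -- The comparison game has a single move, from `true` to `false`, and records only whether the hub
  -- is still there.
  have hgame : IsGrundy (fun b c : Bool => b = true ∧ c = false) Bool.toNat := by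
    simp [IsGrundy]
  have hφh : φ h = h := (hfix h).2 rfl
  refine isGrundy_nimValue.eq_of_simulation hgame (fun G => V(G).ncard + E(G).ncard)
    (fun _ _ h => h.ncard_lt) (fun G b => IsMirrored h φ G ∧ (h ∈ V(G) ↔ b = true)) ?_ ?_
    (q := true) ⟨hG, by simpa using hh⟩
  · rintro G _ ⟨hG, hb⟩ _ ⟨rfl, rfl⟩
    exact ⟨_, .inl ⟨h, hb.2 rfl, rfl⟩, hG.deleteHub hφ hφh, by simp⟩
  · rintro G b ⟨hG, hb⟩ _ (⟨v, hv, rfl⟩ | ⟨e, he, rfl⟩)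
    · by_cases hvh : v = h
      · subst hvh
        exact .inl ⟨false, ⟨hb.1 hv, rfl⟩, hG.deleteHub hφ hφh, by simp⟩
      · have h1 : φ v ≠ v := mt (hfix v).1 hvh
        have h2 : h ≠ φ v := fun h2 => hvh (by rw [← hφ v, ← h2, hφh])
        refine .inr ⟨_, .inl ⟨φ v, ?_, rfl⟩, hG.deleteVerts hφ v, ?_⟩
        · simp [hG.mem_vertexSet v hv, h1]
        · simp [hb, h2, Ne.symm hvh]
    · refine .inr ⟨_, .inr ⟨e.map φ, ?_, rfl⟩, hG.deleteEdges hφ e, ?_⟩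
      · simp [hG.mem_edgeSet e he, hG.map_ne e he]
      · simpa using hb

end IsMirrored

/-! ### Wheels -/

theorem value_true_zero : value true 0 = 1 := by
  have h0 : value false 0 = 0 := by simp [value_false, forestValue, parity]
  rcases lt_trichotomy (value true 0) 1 with h | h | h
  · have := (isGrundy_value (true, 0)).1 _ (.hub 0)
    dsimp only at this
    omega
  · exact h
  · obtain ⟨q, hq, hq1⟩ := (isGrundy_value (true, 0)).2 1 h
    generalize hM : (0 : Multiset (List Bool)) = M at hq
    rcases hq with ⟨M⟩ | @⟨_, w, P, M, hP⟩
    · subst hM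
      dsimp only at hq1
      omega
    · exact absurd hM.symm (Multiset.cons_ne_zero)

/-- A path of even length with all spokes can be cut into two equal parts. -/
theorem value_replicate_ne_one (a : ℕ) :
    value true {List.replicate (2 * a + 2) true} ≠ 1 := by
  have h : Move (true, List.replicate (2 * a + 2) true ::ₘ 0)
      (true, {List.replicate (a + 1) true, List.replicate (a + 1) true} + 0) := by
    rw [show 2 * a + 2 = a + 1 + (a + 1) by omega, List.replicate_add]
    exact .word 0 (.cut _ _ (by simp) (by simp))
  have h1 := (isGrundy_value _).1 _ h
  have h2 := value_cancel true (List.replicate (a + 1) true) 0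
  rw [value_true_zero] at h2
  intro h3
  exact h1 (h2.trans h3.symm)

theorem deleteVerts_comm {α β : Type*} (G : Graph α β) (X Y : Set α) :
    (G.deleteVerts X).deleteVerts Y = (G.deleteVerts Y).deleteVerts X := by
  refine Graph.ext ?_ fun e x y => ?_
  · simp only [Graph.vertexSet_deleteVerts]
    exact Set.sdiff_sdiff_comm
  · simp only [Graph.deleteVerts_isLink]
    tauto

theorem deleteEdges_deleteVerts_comm {α β : Type*} (G : Graph α β) (F : Set β) (X : Set α) :
    (G.deleteEdges F).deleteVerts X = (G.deleteVerts X).deleteEdges F := by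
  refine Graph.ext (by simp) fun e x y => ?_
  simp only [Graph.deleteVerts_isLink, Graph.deleteEdges_isLink]
  tauto

theorem Labelled.deleteEdges_deleteVerts {α : Type*} {G : Graph α (Sym2 α)} (hG : Labelled G)
    {v : α} {e : Sym2 α} (hv : v ∈ e) :
    (G.deleteEdges {e}).deleteVerts {v} = G.deleteVerts {v} := by
  refine Graph.ext (by simp) fun d x y => ?_
  simp only [Graph.deleteVerts_isLink, Graph.deleteEdges_isLink, Set.mem_singleton_iff, hG d]
  constructor
  · exact fun h => ⟨h.1.1, h.2⟩
  · rintro ⟨⟨rfl, h1⟩, h2, h3⟩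
    refine ⟨⟨⟨rfl, h1⟩, ?_⟩, h2, h3⟩
    rintro rfl
    rcases Sym2.mem_iff.1 hv with rfl | rfl
    · exact h2 rfl
    · exact h3 rfl

theorem labelled_wheel (n : ℕ) : Labelled (wheel n) := fun _ _ _ => Iff.rfl

/-! ### Coordinates on the rim, and the two parities of `n`. -/

section Wheel

open scoped Fin.CommRing

variable {N : ℕ}

theorem two_ne_zero_fin : (1 + 1 : Fin (N + 3)) ≠ 0 := by
  have h : ((2 : ℕ) : Fin (N + 3)) ≠ 0 := by
    rw [Ne, Fin.natCast_eq_zero]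
    exact fun h => by have := Nat.le_of_dvd (by norm_num) h; omega
  intro h1
  apply h
  push_cast
  rw [← h1, one_add_one_eq_two]

theorem mem_edgeSet_wheel {e : Sym2 (Option (Fin (N + 3)))} : e ∈ E(wheel (N + 3)) ↔
    (∃ k : Fin (N + 3), e = s(some k, some (k + 1))) ∨ ∃ k : Fin (N + 3), e = s(none, some k) := by
  change e ∈ (simpleWheel (N + 3)).edgeSet ↔ _
  induction e with
  | h x y =>
    rw [SimpleGraph.mem_edgeSet]
    rcases x with _ | x <;> rcases y with _ | y
    · simp [simpleWheel]
    · simp [simpleWheel]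
    · simp [simpleWheel]
    · change x - y = 1 ∨ y - x = 1 ↔ _
      simp only [Sym2.eq_iff, Option.some.injEq, reduceCtorEq, false_and, and_false, or_false,
        exists_false]
      constructor
      · rintro (h | h)
        · exact ⟨y, .inr ⟨by rw [← h]; ring, rfl⟩⟩
        · exact ⟨x, .inl ⟨rfl, by rw [← h]; ring⟩⟩
      · rintro ⟨k, ⟨rfl, rfl⟩ | ⟨rfl, rfl⟩⟩
        · right; ring
        · left; ring

/-- A crosswise coincidence of the ends would force `2 = 0` modulo the rim length, which is at least
3. -/
theorem rim_injective {i k : Fin (N + 3)}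
    (h : s(some k, some (k + 1)) = s(some i, some (i + 1))) : k = i := by
  simp only [Sym2.eq_iff, Option.some.injEq] at h
  rcases h with h | ⟨rfl, h⟩
  · exact h.1
  · refine absurd ?_ (two_ne_zero_fin (N := N))
    linear_combination h

/-- An arc of the rim: the `m` vertices that start with `i`. -/
def arc (i : Fin (N + 3)) (m : ℕ) : List (Option (Fin (N + 3))) :=
  (List.range m).map fun k : ℕ => some (i + (k : Fin (N + 3)))

theorem arc_add (i : Fin (N + 3)) (m n : ℕ) :
    arc i (m + n) = arc i m ++ arc (i + (m : Fin (N + 3))) n := by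
  simp [arc, List.range_add, add_assoc]

theorem arc_succ (i : Fin (N + 3)) (m : ℕ) : arc i (m + 1) = some i :: arc (i + 1) m := by
  rw [add_comm m, arc_add]
  simp [arc]

theorem mem_pathEdges_map_range {α : Type*} {f : ℕ → α} {m : ℕ} {e : Sym2 α} :
    e ∈ pathEdges ((List.range m).map f) ↔ ∃ k, k + 1 < m ∧ e = s(f k, f (k + 1)) := by
  induction m generalizing f with
  | zero => simp [pathEdges]
  | succ m ih =>
    cases m with
    | zero => simp [pathEdges]
    | succ m =>
      have ih := ih (f := f ∘ Nat.succ)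
      rw [List.range_succ_eq_map, List.map_cons, List.map_map]
      rw [List.range_succ_eq_map, List.map_cons] at ih ⊢
      rw [pathEdges, List.mem_cons, ih]
      constructor
      · rintro (rfl | ⟨k, hk, rfl⟩)
        · exact ⟨0, by omega, rfl⟩
        · exact ⟨k + 1, by omega, rfl⟩
      · rintro ⟨_ | k, hk, rfl⟩
        · exact .inl rfl
        · exact .inr ⟨k, by omega, rfl⟩

theorem nodup_arc (i : Fin (N + 3)) : (arc i (N + 3)).Nodup := by
  refine List.Nodup.map_on (fun x hx y hy h => ?_) List.nodup_range
  have h := congrArg Fin.val (add_left_cancel (Option.some_injective _ h))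
  rwa [Fin.val_cast_of_lt (List.mem_range.1 hx), Fin.val_cast_of_lt (List.mem_range.1 hy)] at h

theorem exists_eq_add_natCast (i j : Fin (N + 3)) : ∃ k < N + 3, j = i + (k : Fin (N + 3)) :=
  ⟨(j - i).val, (j - i).isLt, by rw [Fin.cast_val_eq_self]; ring⟩

theorem some_mem_arc (i j : Fin (N + 3)) : some j ∈ arc i (N + 3) := by
  obtain ⟨k, hk, rfl⟩ := exists_eq_add_natCast i j
  exact List.mem_map.2 ⟨k, List.mem_range.2 hk, rfl⟩

theorem none_notMem_arc (i : Fin (N + 3)) (m : ℕ) : none ∉ arc i m := by simp [arc]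

theorem words_arc (i : Fin (N + 3)) (m : ℕ) :
    (arc i m).map (fun _ => true) = List.replicate m true := by
  simp [arc, List.map_const']

/-- A wheel becomes a path with all spokes when a rim edge is deleted. -/
theorem isHubGraph_wheel_deleteEdges (i : Fin (N + 3)) :
    IsHubGraph none (fun _ => true) true [arc (i + 1) (N + 3)]
      ((wheel (N + 3)).deleteEdges {s(some i, some (i + 1))}) where
  nodup := by simpa using nodup_arc (i + 1)
  hub_notMem := by simpa using none_notMem_arc (i + 1) (N + 3)
  labelled := (labelled_wheel _).deleteEdges _
  mem_vertexSet x := by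
    have h : x ∈ V(wheel (N + 3)) := Set.mem_univ x
    simp only [Graph.vertexSet_deleteEdges, h, true_iff, List.flatten_cons, List.flatten_nil,
      List.append_nil, true_and]
    cases x with
    | none => exact .inl rfl
    | some j => exact .inr (some_mem_arc _ j)
  mem_edgeSet e := by
    simp only [Graph.edgeSet_deleteEdges, Set.mem_sdiff, mem_edgeSet_wheel, Set.mem_singleton_iff,
      List.mem_singleton, exists_eq_left, List.flatten_cons, List.flatten_nil,
      List.append_nil, true_and]
    rw [arc, mem_pathEdges_map_range]
    constructor
    · rintro ⟨⟨j, rfl⟩ | ⟨j, rfl⟩, h⟩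
      · left
        obtain ⟨k, hk, rfl⟩ := exists_eq_add_natCast (i + 1) j
        refine ⟨k, ?_, by rw [Nat.cast_succ, add_assoc (i + 1)]⟩
        by_contra hk'
        -- The last vertex of the arc is `i`, and the step from it back to `i + 1` is the deleted
        -- edge.
        obtain rfl : k = N + 2 := by omega
        apply h
        have : i + 1 + ((N + 2 : ℕ) : Fin (N + 3)) = i := by
          have h3 : ((N + 3 : ℕ) : Fin (N + 3)) = 0 := by simp
          push_cast at h3 ⊢
          linear_combination h3
        rw [this]
      · exact .inr ⟨some j, some_mem_arc _ j, rfl⟩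
    · rintro (⟨k, hk, rfl⟩ | ⟨x, hx, rfl⟩)
      · refine ⟨.inl ⟨_, by rw [Nat.cast_succ, ← add_assoc]⟩, fun h => ?_⟩
        push_cast at h
        rw [← add_assoc] at h
        have h := rim_injective h
        have h0 : ((k + 1 : ℕ) : Fin (N + 3)) = 0 := by
          push_cast
          linear_combination h
        rw [Fin.natCast_eq_zero] at h0
        have := Nat.le_of_dvd (by omega) h0
        omega
      · cases x with
        | none => exact absurd hx (none_notMem_arc _ _)
        | some j => exact ⟨.inr ⟨j, rfl⟩, by simp⟩

/-- A wheel becomes a path with all spokes when a rim vertex is deleted. -/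
theorem isHubGraph_wheel_deleteVerts (j : Fin (N + 3)) :
    IsHubGraph none (fun _ => true) true [arc (j + 1) (N + 2)]
      ((wheel (N + 3)).deleteVerts {some j}) := by
  -- Deleting first the rim edge that enters `j` makes `j` the first vertex of a path; this edge
  -- disappears with `j` anyway.
  have h := isHubGraph_wheel_deleteEdges (j - 1)
  rw [sub_add_cancel] at h
  have h1 : arc j (N + 3) = [] ++ some j :: arc (j + 1) (N + 2) := arc_succ j (N + 2)
  rw [h1] at h
  have h2 := h.deleteVert.of_nil_cons
  rwa [(labelled_wheel _).deleteEdges_deleteVerts (by simp)] at h2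

theorem nimValue_wheel_of_even (hN : N % 2 = 1) : nimValue (wheel (N + 3)) = 1 := by
  obtain ⟨a, rfl⟩ : ∃ a, N = 2 * a + 1 := ⟨N / 2, by omega⟩
  -- Half of the rim length `2 * a + 4`: translation by `m` is the antipodal map.
  set m : Fin (2 * a + 1 + 3) := ((a + 2 : ℕ) : Fin (2 * a + 1 + 3)) with hm
  have h1 : m + m = 0 := by
    rw [hm, ← Nat.cast_add, Fin.natCast_eq_zero]
    exact ⟨1, by omega⟩
  have h0 : m ≠ 0 := by
    rw [hm, Ne, Fin.natCast_eq_zero]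
    exact fun h => by have := Nat.le_of_dvd (by omega) h; omega
  refine IsMirrored.nimValue_eq_one (h := none) (φ := Option.map (· + m))
    ⟨labelled_wheel _, fun _ _ => Set.mem_univ _, fun e he => ?_, fun e he => ?_⟩ ?_ ?_
    (Set.mem_univ _)
  · rw [mem_edgeSet_wheel] at he ⊢
    rcases he with ⟨k, rfl⟩ | ⟨k, rfl⟩
    · exact .inl ⟨k + m, by simp [add_right_comm]⟩
    · exact .inr ⟨k + m, by simp⟩
  · rw [mem_edgeSet_wheel] at he
    rcases he with ⟨k, rfl⟩ | ⟨k, rfl⟩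
    · intro h
      have h2 : s(some (k + m), some (k + m + 1)) = s(some k, some (k + 1)) := by
        rw [← h]
        simp [add_right_comm]
      exact h0 (by linear_combination rim_injective h2)
    · simp [h0]
  · rintro (_ | x)
    · rfl
    · simp [add_assoc, h1]
  · rintro (_ | x)
    · simp
    · simp [h0]

/-- An odd cycle is not bipartite, so the parity formula is applied to its options only: a vertex
deletion leaves a path of value 2, an edge deletion one of value 1, and 0 is missed. -/
theorem nimValue_wheel_deleteVerts_none (hN : N % 2 = 0) :
    nimValue ((wheel (N + 3)).deleteVerts {none}) = 0 := by
  by_contra h0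
  obtain ⟨G, hG, h⟩ := (isGrundy_nimValue ((wheel (N + 3)).deleteVerts {none})).2 0 (by omega)
  rcases hG with ⟨v, hv, rfl⟩ | ⟨e, he, rfl⟩
  · cases v with
    | none => simp at hv
    | some j =>
      rw [deleteVerts_comm, (isHubGraph_wheel_deleteVerts j).deleteHub.nimValue_eq, value_false]
        at h
      simp [IsHubGraph.words, arc, forestValue, parity] at h
      omega
  · rw [(labelled_wheel _).mem_edgeSet_deleteVerts, mem_edgeSet_wheel] at he
    rcases he with ⟨⟨i, rfl⟩ | ⟨i, rfl⟩, he⟩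
    · rw [← deleteEdges_deleteVerts_comm,
        (isHubGraph_wheel_deleteEdges i).deleteHub.nimValue_eq, value_false] at h
      simp [IsHubGraph.words, arc, forestValue, parity] at h
      omega
    · simp at he

theorem nimValue_wheel_of_odd (hN : N % 2 = 0) (hN22 : N ≤ 22) :
    nimValue (wheel (N + 3)) = 1 := by
  obtain ⟨a, rfl⟩ : ∃ a, N = 2 * a := ⟨N / 2, by omega⟩
  have hV : ∀ x, x ∈ V(wheel (2 * a + 3)) := Set.mem_univ
  rcases lt_trichotomy (nimValue (wheel (2 * a + 3))) 1 with h | h | h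
  · refine absurd ?_ ((isGrundy_nimValue (wheel (2 * a + 3))).1 _ (.inl ⟨none, hV _, rfl⟩))
    rw [nimValue_wheel_deleteVerts_none (by omega)]
    omega
  · exact h
  exfalso
  obtain ⟨G, hG, h⟩ := (isGrundy_nimValue (wheel (2 * a + 3))).2 1 h
  -- If the value exceeded 1, some option `G` would have value 1; each kind of option is refuted,
  -- for edge deletions by a reply of value 1.
  have key : ∀ H, IsOption G H → nimValue H ≠ 1 := fun H hH => h ▸ (isGrundy_nimValue G).1 H hH
  rcases hG with ⟨v, -, rfl⟩ | ⟨e, he, rfl⟩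
  · cases v with
    | none =>
      rw [nimValue_wheel_deleteVerts_none hN] at h
      omega
    | some j =>
      rw [(isHubGraph_wheel_deleteVerts j).nimValue_eq, IsHubGraph.words_cons, words_arc] at h
      exact value_replicate_ne_one a h
  · rcases mem_edgeSet_wheel.1 he with ⟨i, rfl⟩ | ⟨j, rfl⟩
    · have hG := isHubGraph_wheel_deleteEdges i
      refine key _ (.inl ⟨none, ?_, rfl⟩) ?_
      · simp [hV]
      · rw [hG.deleteHub.nimValue_eq, value_false]
        simp [IsHubGraph.words, arc, forestValue, parity]
    -- The deleted vertex is chosen so that the remaining path starts at `j - a`: `a` vertices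
    -- precede the spokeless vertex `j` and `a + 1` follow it. The bound `N ≤ 22` gives `a < 12`.
    · refine key _ (.inl ⟨some (j - 1 - (a : Fin (2 * a + 3))), by simp [hV], rfl⟩) ?_
      have hG := isHubGraph_wheel_deleteVerts (j - 1 - (a : Fin (2 * a + 3)))
      have h1 : arc (j - 1 - (a : Fin (2 * a + 3)) + 1) (2 * a + 2) =
          arc (j - (a : Fin (2 * a + 3))) a ++ some j :: arc (j + 1) (a + 1) := by
        rw [show 2 * a + 2 = a + (a + 1 + 1) by omega, arc_add, arc_succ]
        have e1 : j - 1 - (a : Fin (2 * a + 3)) + 1 = j - a := by ring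
        have e2 : j - (a : Fin (2 * a + 3)) + a = j := by ring
        rw [e1, e2]
      rw [h1] at hG
      have h2 := hG.deleteSpoke (x := some j) (by simp)
      rw [deleteEdges_deleteVerts_comm, h2.nimValue_eq,
        IsHubGraph.words_update_append hG.nodup, words_arc, words_arc]
      exact Table.value_replicate_false_replicate (by omega)

end Wheel

end GraphTakeAway

theorem theorem8p1 (n : ℕ) (hn3 : 3 ≤ n) (hn25 : n ≤ 25) :
    GraphTakeAway.nimValue (GraphTakeAway.wheel n) = 1 := by
  obtain ⟨N, rfl⟩ := Nat.exists_eq_add_of_le' hn3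
  rcases Nat.mod_two_eq_zero_or_one N with h | h
  · exact GraphTakeAway.nimValue_wheel_of_odd h (by omega)
  · exact GraphTakeAway.nimValue_wheel_of_even h
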